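/- **Theorem 3.7.** *Definitions.* The rank $\mathrm{rk}(x)$ of $x\in\mathbb R^m$ is the sum of its coordinates. A polytope is a nonempty finite union of convex hulls of finite sets, and the rank $\mathrm{rk}(P)$ of a polytope $P$ is the sum of the maximum and the minimum rank of its points. A partial simplex is a simplex with some relatively open faces removed, which still contains its relative interior. A swipe consists of a coordinate direction $e_i$ and two partial simplices $S^s,S^e$ (its starting and ending turning sets) such that translation by non-negative multiples of $e_i$, depending affinely on the point, is a bijection $S^s\to S^e$ and the segments joining corresponding points are pairwise disjoint with convex union; this union is also denoted $S$. A sequence of swipes $S_0,\dots,S_k$ is compatible if $S_i^e=S_{i+1}^s$ for $0\le i<k$. It forms a real snake $\bigcup_i S_i$ if for all $i<j$ every $x\in S_i\cap S_j$ lies in $S_i^e$, in $S_j^s$, and in $S_l^s$ and $S_l^e$ for all $i<l<j$. A point $x\in S_i$ is $i$-halted if it lies in $S_i^s$ and in $S_l^s\cap S_l^e$ for all $l<i$, or in $S_i^e$ and in $S_l^s\cap S_l^e$ for all $l>i$. With $T_i=S_i\setminus\{i\text{-halted points}\}$, the sequence forms a fake snake $\bigcup_i T_i$ if for all $i<j$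 every $x\in T_i\cap T_j$ lies in $T_i\cap S_i^e$, in $T_j\cap S_j^s$, and in $T_l\cap S_l^s$ and $T_l\cap S_l^e$ for all $i<l<j$. A snake is symmetric in $P$ if for every vertex of $\overline{S_0^s}$ and the corresponding vertex of $\overline{S_k^e}$ (under the composite of the bijections) the ranks add up to $\mathrm{rk}(P)$. An asymptotic geometric symmetric chain decomposition of a polytope $P\subset\mathbb R^m$ of dimension $m$ is a finite collection of pairwise disjoint $m$-dimensional symmetric (real or fake) snakes inside $P$ such that the set of points of $P$ in no snake has codimension at least $1$ (is contained in a finite union of proper affine subspaces). It satisfies the weak hyperplane condition if each turning set $S_l^e=S_{l+1}^s$ between consecutive swipes of directions $e_i$ and $e_j$ of a snake lies on a hyperplane $\sum_k a_kx_k=b$ with $a_i=a_j$. The polytope $P$ is volume rank symmetric if for all $r\in\mathbb R$ $$\mathrm{vol}\{x\in P:\mathrm{rk}(x)\le r\}=\mathrm{vol}\{x\in P:\mathrm{rk}(x)\ge \mathrm{rk}(P)-r\}.$$ Let $L(4)=\{x\in\mathbb R^4: 0\le x_1\le x_2\le x_3\le x_4\le 1\}$. For $t\ge 1$ let $L(4)_t=L(4)_{1,\frac1t,t,1}$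 be the image of $L(4)$ under $(x_1,x_2,x_3,x_4)\mapsto(x_1,\frac1t x_2,t x_3,x_4)$, put $\mathbf 1=(0,0,0,1)$, $\mathbf 2=(0,0,t,1)$, $\mathbf 3=(0,\frac1t,t,1)$, $\mathbf 4=(1,\frac1t,t,1)$, $$\mathbf{B'}=\Bigl(0,\tfrac{t+1}{2(t^2+t+1)},\tfrac{t(t+1)^2}{2(t^2+t+1)},\tfrac{t+1}{2t}\Bigr),\qquad P_t=\overline{L(4)_t\setminus\mathrm{conv}(\mathbf{B'1234})}.$$ *Claim.* $P_1=L(4)$. For every $t\ge1$: $\mathrm{conv}(\mathbf{B'1234})\subseteq L(4)_t$, and for $t>1$ this set is a (non-degenerate) $4$-simplex; $P_t$ is a polytope of dimension $4$ and is volume rank symmetric; and $P_t$ has an asymptotic geometric symmetric chain decomposition that satisfies the weak hyperplane condition. -/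

import Mathlib

namespace SymChain

/-- The rank of a point of `ℝ^m`: the sum of its coordinates. -/
def rk {m : ℕ} (x : Fin m → ℝ) : ℝ := ∑ i, x i

/-- A (not necessarily convex, not necessarily full-dimensional) polytope: a nonempty finite union
of convex hulls of finite sets. -/
def IsPolytope {m : ℕ} (P : Set (Fin m → ℝ)) : Prop :=
  P.Nonempty ∧ ∃ F : Set (Set (Fin m → ℝ)), F.Finite ∧ (∀ V ∈ F, V.Finite) ∧
    P = ⋃ V ∈ F, convexHull ℝ V

/-- The rank of a polytope: the sum of the maximum and the minimum rank of its points. -/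
noncomputable def polytopeRank {m : ℕ} (P : Set (Fin m → ℝ)) : ℝ :=
  sSup (rk '' P) + sInf (rk '' P)

/-- The part of `P` of rank at most `r` has the same volume as the part of `P` of rank at least
`rank P - r`, for every `r`. -/
def VolumeRankSymmetric {m : ℕ} (P : Set (Fin m → ℝ)) : Prop :=
  ∀ r : ℝ, MeasureTheory.volume {x ∈ P | rk x ≤ r} =
    MeasureTheory.volume {x ∈ P | polytopeRank P - r ≤ rk x}

/-- The open sub-simplex (relative interior of the convex hull) on the vertices `v j`, `j ∈ I`, of
the simplex with vertices `v 0, …, v n`. -/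
def openSubsimplex {m n : ℕ} (v : Fin (n + 1) → Fin m → ℝ) (I : Finset (Fin (n + 1))) :
    Set (Fin m → ℝ) :=
  {x | ∃ w : Fin (n + 1) → ℝ, (∀ j ∈ I, 0 < w j) ∧ (∀ j ∉ I, w j = 0) ∧ ∑ j, w j = 1 ∧
    x = ∑ j, w j • v j}

/-- A partial simplex: a simplex with some open sub-simplices removed that still contains the
relative interior of the simplex (so the open sub-simplex on all vertices is not removed). -/
def IsPartialSimplex {m : ℕ} (S : Set (Fin m → ℝ)) : Prop :=
  ∃ (n : ℕ) (v : Fin (n + 1) → Fin m → ℝ) (removed : Set (Finset (Fin (n + 1)))),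
    AffineIndependent ℝ v ∧ Finset.univ ∉ removed ∧
    S = convexHull ℝ (Set.range v) \ ⋃ I ∈ removed, openSubsimplex v I

/-- Translation of `x` by the multiple `c x` of the standard basis vector `e_i`. -/
noncomputable def pushAlong {m : ℕ} (i : Fin m) (c : (Fin m → ℝ) →ᵃ[ℝ] ℝ) (x : Fin m → ℝ) :
    Fin m → ℝ :=
  x + c x • Pi.single i (1 : ℝ)

/-- A swipe: a coordinate direction and two partial simplices, the starting and the ending turning
set, in bijection by translation by non-negative multiples of the direction. The multiple depends
affinely on the point, so that the bijection extends to the closed simplices and matches their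
vertices, and the segments that are swept out from different points do not meet. The union of
these segments is convex. -/
structure Swipe (m : ℕ) where
  /-- the coordinate direction -/
  dir : Fin m
  /-- the starting turning set -/
  start : Set (Fin m → ℝ)
  /-- the ending turning set -/
  finish : Set (Fin m → ℝ)
  /-- the multiple of the coordinate direction by which a point is translated -/
  shift : (Fin m → ℝ) →ᵃ[ℝ] ℝ
  isPartialSimplex_start : IsPartialSimplex start
  isPartialSimplex_finish : IsPartialSimplex finish
  shift_nonneg : ∀ x ∈ start, 0 ≤ shift x
  bijOn : Set.BijOn (pushAlong dir shift) start finish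
  disjoint_segments : ∀ x ∈ start, ∀ y ∈ start, x ≠ y →
    Disjoint (segment ℝ x (pushAlong dir shift x)) (segment ℝ y (pushAlong dir shift y))
  convex : Convex ℝ (⋃ x ∈ start, segment ℝ x (pushAlong dir shift x))

/-- The set of points of a swipe: the union of the segments connecting its turning sets. -/
def Swipe.carrier {m : ℕ} (S : Swipe m) : Set (Fin m → ℝ) :=
  ⋃ x ∈ S.start, segment ℝ x (pushAlong S.dir S.shift x)

/-- A compatible sequence of swipes `S_0, …, S_k` (here `k = len`). -/
structure SwipeSeq (m : ℕ) where
  len : ℕ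
  swipe : Fin (len + 1) → Swipe m
  compatible : ∀ i : Fin len, (swipe i.castSucc).finish = (swipe i.succ).start

namespace SwipeSeq

/-- The non self-intersecting condition for a real snake. -/
def IsReal {m : ℕ} (s : SwipeSeq m) : Prop :=
  ∀ i j, i < j → ∀ x ∈ (s.swipe i).carrier ∩ (s.swipe j).carrier,
    x ∈ (s.swipe i).finish ∧ x ∈ (s.swipe j).start ∧
    ∀ k, i < k → k < j → x ∈ (s.swipe k).start ∧ x ∈ (s.swipe k).finish

/-- The `i`-halted points of the swipe `S_i`. -/
def halted {m : ℕ} (s : SwipeSeq m) (i : Fin (s.len + 1)) : Set (Fin m → ℝ) :=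
  {x ∈ (s.swipe i).carrier |
    ((∀ k, k < i → x ∈ (s.swipe k).start ∧ x ∈ (s.swipe k).finish) ∧ x ∈ (s.swipe i).start) ∨
    ((∀ k, i < k → x ∈ (s.swipe k).start ∧ x ∈ (s.swipe k).finish) ∧ x ∈ (s.swipe i).finish)}

/-- `T_i`: the swipe `S_i` without its `i`-halted points. -/
def trimmed {m : ℕ} (s : SwipeSeq m) (i : Fin (s.len + 1)) : Set (Fin m → ℝ) :=
  (s.swipe i).carrier \ s.halted i

/-- The non self-intersecting condition for a fake snake. -/
def IsFake {m : ℕ} (s : SwipeSeq m) : Prop :=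
  ∀ i j, i < j → ∀ x ∈ s.trimmed i ∩ s.trimmed j,
    x ∈ s.trimmed i ∩ (s.swipe i).finish ∧ x ∈ s.trimmed j ∩ (s.swipe j).start ∧
    ∀ k, i < k → k < j →
      x ∈ s.trimmed k ∩ (s.swipe k).start ∧ x ∈ s.trimmed k ∩ (s.swipe k).finish

/-- Symmetry with respect to the polytope `P`: follow any vertex `y 0` of the closure of the first
turning set through the successive bijections, up to the corresponding vertex of the closure of the
last turning set; the ranks of these two vertices add up to the rank of `P`. -/
def IsSymmetric {m : ℕ} (s : SwipeSeq m) (P : Set (Fin m → ℝ)) : Prop :=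
  ∀ y : Fin (s.len + 2) → Fin m → ℝ,
    y 0 ∈ Set.extremePoints ℝ (closure (s.swipe 0).start) →
    (∀ i : Fin (s.len + 1),
      y i.succ = pushAlong (s.swipe i).dir (s.swipe i).shift (y i.castSucc)) →
    rk (y 0) + rk (y (Fin.last (s.len + 1))) = polytopeRank P

/-- Every turning set between two consecutive swipes, of directions `e_i` and `e_j`, lies on a
hyperplane `∑ a_k x_k = b` with `a_i = a_j`. -/
def WeakHyperplaneCondition {m : ℕ} (s : SwipeSeq m) : Prop :=
  ∀ i : Fin s.len, ∃ (a : Fin m → ℝ) (b : ℝ), a ≠ 0 ∧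
    (∀ x ∈ (s.swipe i.castSucc).finish, ∑ k, a k * x k = b) ∧
    a (s.swipe i.castSucc).dir = a (s.swipe i.succ).dir

end SwipeSeq

/-- A snake is real or fake. -/
inductive Snake (m : ℕ) where
  | real (s : SwipeSeq m) (h : s.IsReal) : Snake m
  | fake (s : SwipeSeq m) (h : s.IsFake) : Snake m

/-- The sequence of swipes that forms the snake. -/
def Snake.seq {m : ℕ} : Snake m → SwipeSeq m
  | .real s _ => s
  | .fake s _ => s

/-- The set of points of a snake. -/
def Snake.carrier {m : ℕ} : Snake m → Set (Fin m → ℝ)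
  | .real s _ => ⋃ i, (s.swipe i).carrier
  | .fake s _ => ⋃ i, s.trimmed i

/-- A set of codimension at least one (for a finite union of relatively open polytopes): it is
covered by finitely many proper affine subspaces. -/
def CodimAtLeastOne {m : ℕ} (S : Set (Fin m → ℝ)) : Prop :=
  ∃ F : Set (AffineSubspace ℝ (Fin m → ℝ)), F.Finite ∧ (∀ H ∈ F, H ≠ ⊤) ∧
    S ⊆ ⋃ H ∈ F, (H : Set (Fin m → ℝ))

/-- An asymptotic geometric symmetric chain decomposition of a polytope `P ⊆ ℝ^m` of dimension `m`:
finitely many pairwise disjoint symmetric snakes of dimension `m` inside `P` that cover `P` up to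
a set of codimension at least one. -/
structure AsymptoticGSCD {m : ℕ} (P : Set (Fin m → ℝ)) where
  isPolytope : IsPolytope P
  fullDim : (interior P).Nonempty
  /-- the number of snakes -/
  num : ℕ
  snake : Fin num → Snake m
  subset : ∀ r, (snake r).carrier ⊆ P
  snake_fullDim : ∀ r, (interior (snake r).carrier).Nonempty
  symmetric : ∀ r, (snake r).seq.IsSymmetric P
  disjoint : ∀ r r', r ≠ r' → Disjoint (snake r).carrier (snake r').carrier
  cover : CodimAtLeastOne (P \ ⋃ r, (snake r).carrier)

/-- The weak hyperplane condition for a decomposition. -/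
def AsymptoticGSCD.WeakHyperplaneCondition {m : ℕ} {P : Set (Fin m → ℝ)}
    (D : AsymptoticGSCD P) : Prop :=
  ∀ r, (D.snake r).seq.WeakHyperplaneCondition

/-- The polytope `L(m) = {0 ≤ x_1 ≤ … ≤ x_m ≤ 1}`. -/
def youngPolytope (m : ℕ) : Set (Fin m → ℝ) :=
  {x | Monotone x ∧ ∀ i, 0 ≤ x i ∧ x i ≤ 1}

/-- `L(m)` with the coordinate directions stretched by the factors `s_1, …, s_m`. -/
def stretchedYoungPolytope {m : ℕ} (s : Fin m → ℝ) : Set (Fin m → ℝ) :=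
  (fun x => s * x) '' youngPolytope m

/-- `L(4)_t`, that is `L(4)` stretched by the factors `1, 1/t, t, 1`. -/
noncomputable def stretchedL4 (t : ℝ) : Set (Fin 4 → ℝ) :=
  stretchedYoungPolytope ![1, 1 / t, t, 1]

/-- The points `B', 1, 2, 3, 4`: `B'` and four of the vertices of `L(4)_t`. -/
noncomputable def removedVertex (t : ℝ) : Fin 5 → Fin 4 → ℝ :=
  ![![0, (t + 1) / (2 * (t ^ 2 + t + 1)), t * (t + 1) ^ 2 / (2 * (t ^ 2 + t + 1)),
      (t + 1) / (2 * t)],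
    ![0, 0, 0, 1],
    ![0, 0, t, 1],
    ![0, 1 / t, t, 1],
    ![1, 1 / t, t, 1]]

/-- `conv(B'1234)`. -/
noncomputable def removedSimplex (t : ℝ) : Set (Fin 4 → ℝ) :=
  convexHull ℝ (Set.range (removedVertex t))

/-- The polytope `P_t`: the closure of `L(4)_t` without `conv(B'1234)`. -/
noncomputable def deformedPolytope (t : ℝ) : Set (Fin 4 → ℝ) :=
  closure (stretchedL4 t \ removedSimplex t)

end SymChain

/-! Write 0 for the origin and M for the midpoint of the edge from 0 to 4, so that `L(4)_t` is the
simplex with vertices 0, 1, 2, 3, 4. Up to positive factors, `lam1`, `lam2`, `lam3` are its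
barycentric coordinates at 1, 2, 3, and B' is a point of the facet 0123 where the three agree.
Removing conv(B'1234) therefore leaves three cells conv(B'04ij) with i, j among 1, 2, 3; a point
belongs to the cell whose missing vertex has the smallest functional (`deformedPolytope_eq`,
`nonneg_of_mem_deformedPolytope`). For t = 1 the removed set is flat and nothing is lost.

B' and M both have half the rank of `P_t`, and every turning set is an open simplex on B', M and two
further vertices; only the latter move. Disregarding the common edge B'M, what remains is the
boundary of a bipyramid with apexes 0 and 4 over the triangle 123. Its triangles 0ij and 4ij are the
halves `bal > 0` and `bal < 0` of the cells, and a turning set becomes a segment. With kl for the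
point t/(1+t) k + 1/(1+t) l, the segments of the snake alpha are (0,02), (1,02), (2,02), (3,03),
(3,13), (4,14), (4,24), and those of beta are (0,02), (0,03), (1,13), (1,14), (2,24), (3,24),
(4,24). Each step is a translation in one coordinate direction, because k and k+1 differ in one
coordinate, and each of the six triangles is filled by exactly two of the twelve tubes. The two ends
are complementary: 0 matches 4 and 02 matches 24 in rank. The stretching factors make the weak
hyperplane condition hold at each turn.

That the snakes do not cross themselves or each other is read off from one function, `label`, which
numbers the tubes (`isFake_tubeSeq`, `disjoint_snakes`). Off finitely many hyperplanes every point
of `P_t` is inside a tube (`exists_mem_inner`).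

Volume rank symmetry is independent of the snakes: `P_t` is dissected into four simplices which are
permuted by a rank-reversing correspondence of vertices that preserves volumes
(`volume_convexHull_rk_le`, `det_dissection`). -/

namespace SymChain

open Set

/-! ### Open simplices as partial simplices -/

section Simplices

variable {m n : ℕ}

theorem mem_convexHull_range_iff {ι : Type*} [Fintype ι] {v : ι → Fin m → ℝ} {x : Fin m → ℝ} :
    x ∈ convexHull ℝ (range v) ↔
      ∃ w : ι → ℝ, (∀ j, 0 ≤ w j) ∧ ∑ j, w j = 1 ∧ x = ∑ j, w j • v j := by
  classical
  have h : (Fintype.linearCombination ℝ v) '' stdSimplex ℝ ι = convexHull ℝ (range v) := by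
    rw [← convexHull_rangle_single_eq_stdSimplex, LinearMap.image_convexHull, ← range_comp]
    congr 2
    ext i
    simp [Fintype.linearCombination_apply_single]
  rw [← h]
  constructor
  · rintro ⟨w, ⟨hw, hs⟩, rfl⟩
    exact ⟨w, hw, hs, by simp [Fintype.linearCombination_apply]⟩
  · rintro ⟨w, hw, hs, rfl⟩
    exact ⟨w, ⟨hw, hs⟩, by simp [Fintype.linearCombination_apply]⟩

theorem affineIndependent_of_weights_unique {v : Fin (n + 1) → Fin m → ℝ}
    (h : ∀ w w' : Fin (n + 1) → ℝ, ∑ j, w j = 1 → ∑ j, w' j = 1 →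
      ∑ j, w j • v j = ∑ j, w' j • v j → w = w') : AffineIndependent ℝ v := by
  rw [affineIndependent_iff_of_fintype]
  intro w hw hv i
  rw [Finset.univ.weightedVSub_eq_linear_combination hw] at hv
  -- The weights `w` sum to 0; adding the weights of the vertex `v 0` turns them into barycentric
  -- ones.
  have := h (w + Pi.single 0 1) (Pi.single 0 1) (by simp [Finset.sum_add_distrib, hw])
    (by simp) (by simp [add_smul, Finset.sum_add_distrib, hv])
  simpa using congrFun this i

theorem openSubsimplex_univ {v : Fin (n + 1) → Fin m → ℝ} :
    openSubsimplex v Finset.univ =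
      {x | ∃ w : Fin (n + 1) → ℝ, (∀ j, 0 < w j) ∧ ∑ j, w j = 1 ∧ x = ∑ j, w j • v j} := by
  simp [openSubsimplex]

/-- All proper faces are removed. Unique weights place each point of the closed simplex in just one
open face, the one spanned by the vertices of positive weight. -/
theorem isPartialSimplex_openSubsimplex_univ {v : Fin (n + 1) → Fin m → ℝ}
    (h : ∀ w w' : Fin (n + 1) → ℝ, ∑ j, w j = 1 → ∑ j, w' j = 1 →
      ∑ j, w j • v j = ∑ j, w' j • v j → w = w') :
    IsPartialSimplex (openSubsimplex v Finset.univ) := by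
  refine ⟨n, v, {Finset.univ}ᶜ, affineIndependent_of_weights_unique h, by simp, ?_⟩
  rw [openSubsimplex_univ]
  ext x
  simp only [mem_ofPred_eq, mem_sdiff, mem_convexHull_range_iff, mem_iUnion, not_exists]
  constructor
  · rintro ⟨w, hw, hs, hx⟩
    refine ⟨⟨w, fun j => (hw j).le, hs, hx⟩, fun I hI => ?_⟩
    rintro ⟨w', -, hw', hs', hx'⟩
    have hww := h w w' hs hs' (hx ▸ hx')
    apply hI
    simp only [mem_singleton_iff, Finset.eq_univ_iff_forall]
    intro j
    by_contra hj
    exact (hw j).ne' (hww ▸ hw' j hj)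
  · rintro ⟨⟨w, hw, hs, hx⟩, hno⟩
    refine ⟨w, ?_, hs, hx⟩
    by_contra hcon
    push Not at hcon
    obtain ⟨j, hj⟩ := hcon
    refine hno (Finset.univ.filter fun j => 0 < w j) ?_ ⟨w, by simp, ?_, hs, hx⟩
    · simp only [mem_compl_iff, mem_singleton_iff, Finset.eq_univ_iff_forall]
      intro hall
      have := hall j
      simp only [Finset.mem_filter, Finset.mem_univ, true_and] at this
      linarith
    · intro k hk
      simp only [Finset.mem_filter, Finset.mem_univ, true_and, not_lt] at hk
      exact le_antisymm hk (hw k)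

theorem closure_openSubsimplex_univ {v : Fin (n + 1) → Fin m → ℝ} :
    closure (openSubsimplex v Finset.univ) = convexHull ℝ (range v) := by
  rw [openSubsimplex_univ]
  apply Subset.antisymm
  · refine closure_minimal ?_ ((finite_range v).isCompact_convexHull (𝕜 := ℝ)).isClosed
    rintro x ⟨w, hw, hs, hx⟩
    exact mem_convexHull_range_iff.2 ⟨w, fun j => (hw j).le, hs, hx⟩
  · intro x hx
    obtain ⟨w, hw, hs, rfl⟩ := mem_convexHull_range_iff.1 hx
    -- The barycentre: a point of the closed simplex moved slightly towards it has positive weights.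
    let u : Fin (n + 1) → ℝ := fun _ => 1 / (n + 1)
    have hu : ∑ j, u j = 1 := by
      simp only [u, Finset.sum_const, Finset.card_univ, Fintype.card_fin, nsmul_eq_mul]
      push_cast
      field_simp
    let f : ℝ → Fin m → ℝ := fun s => ∑ j, ((1 - s) * w j + s * u j) • v j
    have hf : ContinuousWithinAt f (Ioo 0 1) 0 := by
      apply Continuous.continuousWithinAt
      fun_prop
    have h0 : f 0 = ∑ j, w j • v j := by simp [f]
    rw [← h0]
    refine hf.mem_closure ?_ ?_
    · rw [closure_Ioo (zero_ne_one' ℝ)]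
      simp
    · intro s hs'
      refine ⟨_, fun j => ?_, ?_, rfl⟩
      · have h1 : 0 ≤ (1 - s) * w j := mul_nonneg (by linarith [hs'.2]) (hw j)
        have h2 : 0 < s * u j := mul_pos hs'.1 (by positivity)
        linarith
      · rw [Finset.sum_add_distrib, ← Finset.mul_sum, ← Finset.mul_sum, hs, hu]
        ring

end Simplices

/-! ### Tubes and the swipes that they form -/

/-- A tube in `ℝ^(n+1)`: the union of the segments in the coordinate direction `dir` that join the
points `∑ w j • v j` of an open simplex to `∑ w j • (v j + c j • e_dir)`. The affine functions
`weight j` and `height` are the coordinates of a point with respect to the tube. -/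
structure Tube (n : ℕ) where
  dir : Fin (n + 1)
  vertex : Fin (n + 1) → Fin (n + 1) → ℝ
  push : Fin (n + 1) → ℝ
  weight : Fin (n + 1) → (Fin (n + 1) → ℝ) →ᵃ[ℝ] ℝ
  height : (Fin (n + 1) → ℝ) →ᵃ[ℝ] ℝ
  push_nonneg : ∀ j, 0 ≤ push j
  push_pos : ∃ j, 0 < push j
  sum_weight : ∀ x, ∑ j, weight j x = 1
  eq_sum : ∀ x, ∑ j, weight j x • vertex j + height x • Pi.single dir (1 : ℝ) = x

namespace Tube

variable {n : ℕ} (T : Tube n)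

/-- A tube supplies coordinates of every point, so the linear map from coordinates to points is
surjective. Its source and target have the same dimension, so uniqueness is free; the tubes below
need only verify two identities. -/
theorem coords_injective : Function.Injective
    (fun p : (Fin (n + 1) → ℝ) × ℝ =>
      ((∑ j, p.1 j • T.vertex j + p.2 • Pi.single T.dir (1 : ℝ), ∑ j, p.1 j) :
        (Fin (n + 1) → ℝ) × ℝ)) := by
  let Φ : ((Fin (n + 1) → ℝ) × ℝ) →ₗ[ℝ] ((Fin (n + 1) → ℝ) × ℝ) :=
    { toFun := fun p => (∑ j, p.1 j • T.vertex j + p.2 • Pi.single T.dir (1 : ℝ), ∑ j, p.1 j)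
      map_add' := fun p q => by
        ext <;> simp [add_smul, Finset.sum_add_distrib]; ring
      map_smul' := fun a p => by
        ext <;> simp [mul_smul, Finset.mul_sum] }
  have hone : ∀ x, Φ (fun j => T.weight j x, T.height x) = (x, 1) := fun x =>
    Prod.ext (T.eq_sum x) (T.sum_weight x)
  have hsurj : Function.Surjective Φ := by
    rintro ⟨y, s⟩
    -- The coordinates of the origin are sent to (0, 1) and hence correct the sum of the weights
    -- from 1 to `s`.
    refine ⟨(fun j => T.weight j y, T.height y) +
      (s - 1) • (fun j => T.weight j 0, T.height 0), ?_⟩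
    rw [map_add, map_smul, hone, hone]
    ext <;> simp
  exact LinearMap.injective_iff_surjective.2 hsurj

theorem coords_unique {w : Fin (n + 1) → ℝ} {s : ℝ} {x : Fin (n + 1) → ℝ} (hw : ∑ j, w j = 1)
    (hx : x = ∑ j, w j • T.vertex j + s • Pi.single T.dir (1 : ℝ)) :
    (∀ j, T.weight j x = w j) ∧ T.height x = s := by
  have := @coords_injective n T (fun j => T.weight j x, T.height x) (w, s) (by
    simp only [Prod.mk.injEq]
    exact ⟨(T.eq_sum x).trans hx, (T.sum_weight x).trans hw.symm⟩)
  rw [Prod.mk.injEq] at this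
  exact ⟨fun j => congrFun this.1 j, this.2⟩

/-- The length of the segment of the tube in which a point lies. -/
noncomputable def length : (Fin (n + 1) → ℝ) →ᵃ[ℝ] ℝ := ∑ j, T.push j • T.weight j

theorem length_apply (x : Fin (n + 1) → ℝ) : T.length x = ∑ j, T.push j * T.weight j x := by
  have h : ∀ s : Finset (Fin (n + 1)),
      (∑ j ∈ s, T.push j • T.weight j) x = ∑ j ∈ s, T.push j * T.weight j x := by
    intro s
    induction s using Finset.induction_on with
    | empty => simp
    | insert a s ha ih => simp [Finset.sum_insert ha, ih]
  exact h _

theorem add_dir (x : Fin (n + 1) → ℝ) (s : ℝ) :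
    (∀ j, T.weight j (x + s • Pi.single T.dir (1 : ℝ)) = T.weight j x) ∧
      T.height (x + s • Pi.single T.dir (1 : ℝ)) = T.height x + s := by
  apply T.coords_unique (T.sum_weight x)
  rw [add_smul, ← add_assoc, T.eq_sum]

theorem length_add_dir (x : Fin (n + 1) → ℝ) (s : ℝ) :
    T.length (x + s • Pi.single T.dir (1 : ℝ)) = T.length x := by
  simp only [length_apply, (T.add_dir x s).1]

/-- The starting turning set of a tube. -/
def bottom : Set (Fin (n + 1) → ℝ) := {x | (∀ j, 0 < T.weight j x) ∧ T.height x = 0}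

/-- The ending turning set of a tube. -/
def top : Set (Fin (n + 1) → ℝ) := {x | (∀ j, 0 < T.weight j x) ∧ T.height x = T.length x}

theorem bottom_eq : T.bottom = openSubsimplex T.vertex Finset.univ := by
  rw [openSubsimplex_univ]
  ext x
  constructor
  · rintro ⟨h, h0⟩
    refine ⟨_, h, T.sum_weight x, ?_⟩
    have := T.eq_sum x
    rw [h0, zero_smul, add_zero] at this
    exact this.symm
  · rintro ⟨w, hw, hs, hx⟩
    obtain ⟨h1, h2⟩ := T.coords_unique (s := 0) hs (by simpa using hx)
    exact ⟨fun j => (h1 j).symm ▸ hw j, h2⟩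

/-- The vertices of the ending turning set. -/
def pushedVertex (j : Fin (n + 1)) : Fin (n + 1) → ℝ :=
  T.vertex j + T.push j • Pi.single T.dir (1 : ℝ)

theorem sum_pushedVertex (w : Fin (n + 1) → ℝ) :
    ∑ j, w j • T.pushedVertex j =
      ∑ j, w j • T.vertex j + (∑ j, T.push j * w j) • Pi.single T.dir (1 : ℝ) := by
  simp only [pushedVertex, smul_add, Finset.sum_add_distrib, Finset.sum_smul, smul_smul, mul_comm]

theorem top_eq : T.top = openSubsimplex T.pushedVertex Finset.univ := by
  rw [openSubsimplex_univ]
  ext x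
  constructor
  · rintro ⟨h, h0⟩
    refine ⟨_, h, T.sum_weight x, ?_⟩
    have := T.eq_sum x
    rw [h0, length_apply] at this
    rw [sum_pushedVertex]
    exact this.symm
  · rintro ⟨w, hw, hs, hx⟩
    rw [sum_pushedVertex] at hx
    obtain ⟨h1, h2⟩ := T.coords_unique hs hx
    refine ⟨fun j => (h1 j).symm ▸ hw j, ?_⟩
    rw [h2, length_apply]
    simp [h1]

/-- All weights being positive, one moving vertex is enough; no segment of a tube degenerates, and
the starting and ending turning sets are disjoint. -/
theorem length_pos {x : Fin (n + 1) → ℝ} (hx : ∀ j, 0 < T.weight j x) : 0 < T.length x := by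
  rw [length_apply]
  obtain ⟨j, hj⟩ := T.push_pos
  exact Finset.sum_pos' (fun i _ => mul_nonneg (T.push_nonneg i) (hx i).le)
    ⟨j, Finset.mem_univ j, mul_pos hj (hx j)⟩

theorem mem_segment_iff {x z : Fin (n + 1) → ℝ} (hx : x ∈ T.bottom) :
    z ∈ segment ℝ x (pushAlong T.dir T.length x) ↔
      ∃ s, 0 ≤ s ∧ s ≤ T.length x ∧ z = x + s • Pi.single T.dir (1 : ℝ) := by
  have hl := T.length_pos hx.1
  rw [segment_eq_image']
  simp only [mem_image, pushAlong, add_sub_cancel_left, smul_smul]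
  constructor
  · rintro ⟨θ, ⟨h0, h1⟩, rfl⟩
    exact ⟨θ * T.length x, by positivity, by nlinarith, rfl⟩
  · rintro ⟨s, h0, h1, rfl⟩
    exact ⟨s / T.length x, ⟨by positivity, by rwa [div_le_one hl]⟩, by
      rw [div_mul_cancel₀ _ hl.ne']⟩

theorem sub_height_mem {x : Fin (n + 1) → ℝ} (hx : ∀ j, 0 < T.weight j x) :
    x - T.height x • Pi.single T.dir (1 : ℝ) ∈ T.bottom := by
  rw [sub_eq_add_neg, ← neg_smul]
  exact ⟨fun j => ((T.add_dir x _).1 j).symm ▸ hx j, by rw [(T.add_dir x _).2]; ring⟩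

theorem iUnion_segment :
    ⋃ x ∈ T.bottom, segment ℝ x (pushAlong T.dir T.length x) =
      {x | (∀ j, 0 < T.weight j x) ∧ 0 ≤ T.height x ∧ T.height x ≤ T.length x} := by
  ext z
  simp only [mem_iUnion, exists_prop, mem_ofPred_eq]
  constructor
  · rintro ⟨x, hx, hz⟩
    obtain ⟨s, h0, h1, rfl⟩ := (T.mem_segment_iff hx).1 hz
    rw [(T.add_dir x s).2, hx.2, length_add_dir]
    exact ⟨fun j => ((T.add_dir x s).1 j).symm ▸ hx.1 j, by linarith, by linarith⟩
  · rintro ⟨h, h0, h1⟩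
    refine ⟨_, T.sub_height_mem h, (T.mem_segment_iff (T.sub_height_mem h)).2
      ⟨T.height z, h0, ?_, by simp⟩⟩
    rwa [sub_eq_add_neg, ← neg_smul, length_add_dir]

/-- The swipe formed by a tube. -/
noncomputable def toSwipe : Swipe (n + 1) where
  dir := T.dir
  start := T.bottom
  finish := T.top
  shift := T.length
  isPartialSimplex_start := by
    rw [bottom_eq]
    refine isPartialSimplex_openSubsimplex_univ fun w w' hw hw' h => ?_
    have h1 := T.coords_unique (s := 0) hw rfl
    have h2 := T.coords_unique (s := 0) hw' (by rw [← h])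
    exact funext fun j => (h1.1 j).symm.trans (h2.1 j)
  isPartialSimplex_finish := by
    rw [top_eq]
    refine isPartialSimplex_openSubsimplex_univ fun w w' hw hw' h => ?_
    rw [sum_pushedVertex, sum_pushedVertex] at h
    have h1 := T.coords_unique (s := ∑ j, T.push j * w j) hw rfl
    have h2 := T.coords_unique hw' h
    exact funext fun j => (h1.1 j).symm.trans (h2.1 j)
  shift_nonneg := fun x hx => (T.length_pos hx.1).le
  bijOn := by
    refine ⟨fun x hx => ?_, fun x hx y hy hxy => ?_, fun x hx => ?_⟩
    · simp only [pushAlong]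
      refine ⟨fun j => ((T.add_dir x _).1 j).symm ▸ hx.1 j, ?_⟩
      rw [(T.add_dir x _).2, hx.2, length_add_dir, zero_add]
    · simp only [pushAlong] at hxy
      rw [← T.eq_sum x, ← T.eq_sum y, hx.2, hy.2]
      congr 1
      refine Finset.sum_congr rfl fun j _ => ?_
      rw [← (T.add_dir x (T.length x)).1 j, hxy, (T.add_dir y (T.length y)).1 j]
    · refine ⟨_, T.sub_height_mem hx.1, ?_⟩
      simp only [pushAlong]
      rw [sub_eq_add_neg, ← neg_smul, length_add_dir, hx.2, neg_smul, add_assoc, neg_add_cancel,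
        add_zero]
  disjoint_segments := by
    intro x hx y hy hxy
    rw [Set.disjoint_left]
    intro z hz hz'
    obtain ⟨s, -, -, rfl⟩ := (T.mem_segment_iff hx).1 hz
    obtain ⟨s', -, -, h⟩ := (T.mem_segment_iff hy).1 hz'
    apply hxy
    rw [← T.eq_sum x, ← T.eq_sum y, hx.2, hy.2]
    congr 1
    refine Finset.sum_congr rfl fun j _ => ?_
    rw [← (T.add_dir x s).1 j, h, (T.add_dir y s').1 j]
  convex := by
    rw [iUnion_segment]
    have h1 : Convex ℝ {x | ∀ j, 0 < T.weight j x} := by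
      rw [ofPred_forall]
      exact convex_iInter fun j => (convex_Ioi (0 : ℝ)).affine_preimage (T.weight j)
    have h2 : Convex ℝ {x | 0 ≤ T.height x} := (convex_Ici (0 : ℝ)).affine_preimage T.height
    have h3 : Convex ℝ {x | T.height x ≤ T.length x} := by
      have := (convex_Ici (0 : ℝ)).affine_preimage (T.length - T.height)
      simpa [preimage, sub_nonneg] using this
    exact h1.inter (h2.inter h3)

theorem mem_carrier_iff {x : Fin (n + 1) → ℝ} :
    x ∈ T.toSwipe.carrier ↔
      (∀ j, 0 < T.weight j x) ∧ 0 ≤ T.height x ∧ T.height x ≤ T.length x := by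
  have := T.iUnion_segment
  change x ∈ ⋃ x ∈ T.bottom, segment ℝ x (pushAlong T.dir T.length x) ↔ _
  rw [this]
  rfl

/-- The interior of a tube. -/
def inner : Set (Fin (n + 1) → ℝ) :=
  {x | (∀ j, 0 < T.weight j x) ∧ 0 < T.height x ∧ T.height x < T.length x}

theorem continuous_affineMap (f : (Fin (n + 1) → ℝ) →ᵃ[ℝ] ℝ) : Continuous f :=
  f.continuous_of_finiteDimensional

theorem isOpen_inner : IsOpen T.inner := by
  have h1 : IsOpen {x | ∀ j, 0 < T.weight j x} := by
    rw [ofPred_forall]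
    exact isOpen_iInter_of_finite fun j =>
      isOpen_lt continuous_const (continuous_affineMap (T.weight j))
  exact h1.inter ((isOpen_lt continuous_const (continuous_affineMap T.height)).inter
    (isOpen_lt (continuous_affineMap T.height) (continuous_affineMap T.length)))

theorem inner_nonempty : T.inner.Nonempty := by
  let u : Fin (n + 1) → ℝ := fun _ => 1 / (n + 1)
  have hu : ∑ j, u j = 1 := by
    simp only [u, Finset.sum_const, Finset.card_univ, Fintype.card_fin, nsmul_eq_mul]
    push_cast
    field_simp
  have h0 := T.coords_unique (s := 0) hu rfl
  generalize ∑ j, u j • T.vertex j + (0 : ℝ) • Pi.single T.dir (1 : ℝ) = y at h0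
  have hpos : ∀ j, 0 < T.weight j y := fun j => by rw [h0.1]; positivity
  have hl := T.length_pos hpos
  refine ⟨y + (T.length y / 2) • Pi.single T.dir (1 : ℝ), ?_, ?_, ?_⟩
  · exact fun j => ((T.add_dir y _).1 j).symm ▸ hpos j
  · rw [(T.add_dir y _).2, h0.2]
    linarith
  · rw [(T.add_dir y _).2, h0.2, length_add_dir]
    linarith

theorem pushAlong_vertex (j : Fin (n + 1)) :
    pushAlong T.dir T.length (T.vertex j) = T.pushedVertex j := by
  have := T.coords_unique (w := Pi.single j 1) (s := 0) (x := T.vertex j) (by simp)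
    (by simp [Pi.single_apply])
  simp [pushAlong, pushedVertex, length_apply, this.1, Pi.single_apply]

end Tube

/-! ### Fake snakes built from tubes -/

/-- The sequence of swipes formed by tubes each of which ends where the next one starts. -/
noncomputable def tubeSeq {n k : ℕ} (T : Fin (k + 1) → Tube n)
    (h : ∀ (i : Fin k) j, (T i.castSucc).pushedVertex j = (T i.succ).vertex j) :
    SwipeSeq (n + 1) where
  len := k
  swipe := fun i => (T i).toSwipe
  compatible := fun i => by
    change (T i.castSucc).top = (T i.succ).bottom
    rw [Tube.top_eq, Tube.bottom_eq]
    congr 1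
    exact funext (h i)

section

variable {n k : ℕ} {T : Fin (k + 1) → Tube n}
  {h : ∀ (i : Fin k) j, (T i.castSucc).pushedVertex j = (T i.succ).vertex j}

/-- For the first swipe the condition on earlier swipes is vacuous, and for the last one that on
later swipes, so the two extreme turning sets are halted. This is what lets different snakes share
their ends. -/
theorem mem_trimmed_tubeSeq {i : Fin (k + 1)} {x : Fin (n + 1) → ℝ}
    (hx : x ∈ (tubeSeq T h).trimmed i) :
    x ∈ (T i).toSwipe.carrier ∧ (i = 0 → x ∉ (T i).bottom) ∧ (i = Fin.last k → x ∉ (T i).top) := by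
  refine ⟨hx.1, fun hi hb => hx.2 ⟨hx.1, Or.inl ⟨fun l hl => ?_, hb⟩⟩,
    fun hi hb => hx.2 ⟨hx.1, Or.inr ⟨fun l hl => ?_, hb⟩⟩⟩
  · subst hi
    exact absurd hl (Fin.not_lt_zero l)
  · subst hi
    exact absurd hl (Fin.le_last l).not_gt

theorem inner_subset_trimmed_tubeSeq (i : Fin (k + 1)) :
    (T i).inner ⊆ (tubeSeq T h).trimmed i := by
  rintro x ⟨hw, h0, h1⟩
  refine ⟨(T i).mem_carrier_iff.2 ⟨hw, h0.le, h1.le⟩, ?_⟩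
  rintro ⟨-, ⟨-, hb⟩ | ⟨-, hb⟩⟩
  · exact h0.ne' hb.2
  · exact h1.ne hb.2

/-- A labelling of the space by numbers that is constant on each tube without its ending turning
set, and numbers the tubes consecutively. -/
def IsLabelling (T : Fin (k + 1) → Tube n) (f : (Fin (n + 1) → ℝ) → ℕ) (N : ℕ) : Prop :=
  ∀ i x, (∀ j, 0 < (T i).weight j x) → 0 ≤ (T i).height x → (T i).height x < (T i).length x →
    (i = 0 → 0 < (T i).height x) → f x = N + i

/-- An ending turning set is the starting one of the next tube and so takes the next label; the last
ending turning set, which has no successor, is trimmed away. -/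
theorem label_of_mem_trimmed {f : (Fin (n + 1) → ℝ) → ℕ} {N : ℕ} (hf : IsLabelling T f N)
    {i : Fin (k + 1)} {x : Fin (n + 1) → ℝ} (hx : x ∈ (tubeSeq T h).trimmed i) :
    (x ∉ (T i).top ∧ f x = N + i) ∨
      ∃ j : Fin k, i = j.castSucc ∧ x ∈ (T i).top ∧ x ∈ (T j.succ).bottom ∧ f x = N + (i + 1) := by
  obtain ⟨hc, hb, ht⟩ := mem_trimmed_tubeSeq hx
  rw [Tube.mem_carrier_iff] at hc
  by_cases hxt : x ∈ (T i).top
  · right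
    have hi : i ≠ Fin.last k := fun hi => ht hi hxt
    obtain ⟨j, rfl⟩ := Fin.exists_castSucc_eq.2 hi
    have hxb : x ∈ (T j.succ).bottom := by
      have := (tubeSeq T h).compatible j
      change (T j.castSucc).top = (T j.succ).bottom at this
      exact this ▸ hxt
    refine ⟨j, rfl, hxt, hxb, ?_⟩
    rw [hf j.succ x hxb.1 hxb.2.ge (by rw [hxb.2]; exact (T j.succ).length_pos hxb.1)
      (fun h0 => absurd h0 (Fin.succ_ne_zero j))]
    simp
  · left
    refine ⟨hxt, hf i x hc.1 hc.2.1 (lt_of_le_of_ne hc.2.2 fun he => hxt ⟨hc.1, he⟩) fun hi => ?_⟩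
    exact lt_of_le_of_ne hc.2.1 fun he => hb hi ⟨hc.1, he.symm⟩

/-- A common point has one label, while its label in a tube exceeds the number of the tube by `N`
or, on the ending turning set, by `N + 1`. Hence the two tubes are consecutive and the point is on
their common turning set. -/
theorem isFake_tubeSeq {f : (Fin (n + 1) → ℝ) → ℕ} {N : ℕ} (hf : IsLabelling T f N) :
    (tubeSeq T h).IsFake := by
  intro (i : Fin (k + 1)) (j : Fin (k + 1)) hij x ⟨hi, hj⟩
  have hij' : (i : ℕ) < j := hij
  rcases label_of_mem_trimmed hf hi with ⟨-, h1⟩ | ⟨l, rfl, hl1, hl2, h1⟩ <;>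
  rcases label_of_mem_trimmed hf hj with ⟨-, h2⟩ | ⟨l', rfl, hl1', hl2', h2⟩
  · omega
  · omega
  · have hlj : j = l.succ := by
      ext
      simp only [Fin.val_castSucc, Fin.val_succ] at *
      omega
    subst hlj
    refine ⟨⟨hi, hl1⟩, ⟨hj, hl2⟩, fun (m : Fin (k + 1)) hm1 hm2 => ?_⟩
    have hm1' : (l.castSucc : ℕ) < m := hm1
    have hm2' : (m : ℕ) < l.succ := hm2
    simp only [Fin.val_castSucc, Fin.val_succ] at *
    omega
  · omega

theorem label_mem_of_mem_carrier {f : (Fin (n + 1) → ℝ) → ℕ} {N : ℕ} (hf : IsLabelling T f N)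
    {x : Fin (n + 1) → ℝ} (hx : x ∈ ⋃ i, (tubeSeq T h).trimmed i) :
    N ≤ f x ∧ f x ≤ N + k := by
  obtain ⟨i, hi⟩ := mem_iUnion.1 hx
  change Fin (k + 1) at i
  rcases label_of_mem_trimmed hf hi with ⟨-, h1⟩ | ⟨l, rfl, -, -, h1⟩
  · have := i.2
    omega
  · have := l.2
    simp only [Fin.val_castSucc] at h1
    omega

/-- Extreme points of the closed first turning set are among its listed vertices, and following one
through the bijections leads to the vertices with the same index. -/
theorem isSymmetric_tubeSeq {P : Set (Fin (n + 1) → ℝ)}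
    (hP : ∀ j, rk ((T 0).vertex j) + rk ((T (Fin.last k)).pushedVertex j) = polytopeRank P) :
    (tubeSeq T h).IsSymmetric P := by
  intro y hy0 hy
  change ∀ i : Fin (k + 1), y i.succ = pushAlong (T i).dir (T i).length (y i.castSucc) at hy
  change y 0 ∈ extremePoints ℝ (closure (T 0).bottom) at hy0
  rw [Tube.bottom_eq, closure_openSubsimplex_univ] at hy0
  obtain ⟨j, hj⟩ := extremePoints_convexHull_subset hy0
  have key : ∀ i : Fin (k + 1), y i.castSucc = (T i).vertex j := by
    intro i
    induction i using Fin.induction with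
    | zero => exact hj.symm
    | succ i ih =>
      rw [← h i j, ← Tube.pushAlong_vertex, ← ih, ← Fin.succ_castSucc]
      exact hy i.castSucc
  change rk (y 0) + rk (y (Fin.last (k + 1))) = _
  rw [← hP j, ← Fin.succ_last, hy, key (Fin.last k), Tube.pushAlong_vertex, hj]

theorem weakHyperplaneCondition_tubeSeq
    (H : ∀ i : Fin k, ∃ (a : Fin (n + 1) → ℝ) (b : ℝ), a ≠ 0 ∧
      (∀ j, ∑ l, a l * (T i.succ).vertex j l = b) ∧ a (T i.castSucc).dir = a (T i.succ).dir) :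
    (tubeSeq T h).WeakHyperplaneCondition := by
  intro (i : Fin k)
  obtain ⟨a, b, ha, hv, hd⟩ := H i
  refine ⟨a, b, ha, fun x hx => ?_, hd⟩
  have hx' : x ∈ (T i.succ).bottom := by
    have := (tubeSeq T h).compatible i
    rw [this] at hx
    exact hx
  rw [Tube.bottom_eq, openSubsimplex_univ] at hx'
  obtain ⟨w, -, hs, rfl⟩ := hx'
  calc ∑ l, a l * (∑ j, w j • (T i.succ).vertex j) l
      = ∑ j, w j * ∑ l, a l * (T i.succ).vertex j l := by
        simp only [Finset.sum_apply, Pi.smul_apply, smul_eq_mul, Finset.mul_sum]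
        rw [Finset.sum_comm]
        exact Finset.sum_congr rfl fun _ _ => Finset.sum_congr rfl fun _ _ => by ring
    _ = b := by simp only [hv, ← Finset.sum_mul, hs, one_mul]

end

/-! ### Functionals adapted to the three cells of `P_t` -/

section Functionals

/-- The coordinates as affine functions. -/
noncomputable def coord (i : Fin 4) : (Fin 4 → ℝ) →ᵃ[ℝ] ℝ :=
  (LinearMap.proj i : (Fin 4 → ℝ) →ₗ[ℝ] ℝ).toAffineMap

@[simp] theorem coord_apply (i : Fin 4) (x : Fin 4 → ℝ) : coord i x = x i := rfl

/-- The multiple `t² (x_4 - x_3 / t)` of the barycentric coordinate of `L(4)_t` at `(0,0,0,1)`. -/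
noncomputable def lam1 (t : ℝ) : (Fin 4 → ℝ) →ᵃ[ℝ] ℝ := t ^ 2 • coord 3 - t • coord 2

/-- The multiple `t (x_3 / t - t x_2)` of the barycentric coordinate of `L(4)_t` at `(0,0,t,1)`. -/
noncomputable def lam2 (t : ℝ) : (Fin 4 → ℝ) →ᵃ[ℝ] ℝ := coord 2 - t ^ 2 • coord 1

/-- The barycentric coordinate of `L(4)_t` at `(0,1/t,t,1)`. -/
noncomputable def lam3 (t : ℝ) : (Fin 4 → ℝ) →ᵃ[ℝ] ℝ := t • coord 1 - coord 0

/-- The quotient of the barycentric coordinates of `B'` at `0` and at `(0,1/t,t,1)`. -/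
noncomputable def kap (t : ℝ) : ℝ := (t ^ 3 - 1) / (t ^ 2 * (t + 1))

/-- The inverse of the barycentric coordinate of `B'` at `(0,1/t,t,1)`. -/
noncomputable def gam (t : ℝ) : ℝ := 2 * (t ^ 2 + t + 1) / (t * (t + 1))

/-- In a cell, that is, in the convex hull of `B'`, `0`, `4` and two of the vertices `1`, `2`, `3`,
the difference of the weights of `0` and `4`; here `f` is `lam1 t`, `lam2 t` or `lam3 t` according
to which of the vertices `1`, `2`, `3` is missing. -/
noncomputable def bal (t : ℝ) (f : (Fin 4 → ℝ) →ᵃ[ℝ] ℝ) : (Fin 4 → ℝ) →ᵃ[ℝ] ℝ :=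
  AffineMap.const ℝ _ 1 - coord 3 - coord 0 - kap t • f

theorem lam1_apply (t : ℝ) (x : Fin 4 → ℝ) : lam1 t x = t ^ 2 * x 3 - t * x 2 := rfl

theorem lam2_apply (t : ℝ) (x : Fin 4 → ℝ) : lam2 t x = x 2 - t ^ 2 * x 1 := rfl

theorem lam3_apply (t : ℝ) (x : Fin 4 → ℝ) : lam3 t x = t * x 1 - x 0 := rfl

theorem bal_apply (t : ℝ) (f : (Fin 4 → ℝ) →ᵃ[ℝ] ℝ) (x : Fin 4 → ℝ) :
    bal t f x = 1 - x 3 - x 0 - kap t * f x := rfl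

end Functionals

section Points

/-- The point `B'`. -/
noncomputable def ptB (t : ℝ) : Fin 4 → ℝ := removedVertex t 0

/-- The vertex `1`. -/
def pt1 : Fin 4 → ℝ := ![0, 0, 0, 1]

/-- The vertex `2`. -/
def pt2 (t : ℝ) : Fin 4 → ℝ := ![0, 0, t, 1]

/-- The vertex `3`. -/
noncomputable def pt3 (t : ℝ) : Fin 4 → ℝ := ![0, 1 / t, t, 1]

/-- The vertex `4`. -/
noncomputable def pt4 (t : ℝ) : Fin 4 → ℝ := ![1, 1 / t, t, 1]

/-- The midpoint of the edge from `0` to `4`. -/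
noncomputable def ptM (t : ℝ) : Fin 4 → ℝ := ![1 / 2, 1 / (2 * t), t / 2, 1 / 2]

/-- The point of rank one on the edge from `0` to `2`. -/
noncomputable def pt02 (t : ℝ) : Fin 4 → ℝ := ![0, 0, t / (1 + t), 1 / (1 + t)]

/-- The point with the weights of `pt02` on the edge from `0` to `3`. -/
noncomputable def pt03 (t : ℝ) : Fin 4 → ℝ := ![0, 1 / (t * (1 + t)), t / (1 + t), 1 / (1 + t)]

/-- The point with the weights of `pt02` on the edge from `1` to `3`. -/
noncomputable def pt13 (t : ℝ) : Fin 4 → ℝ := ![0, 1 / (t * (1 + t)), t / (1 + t), 1]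

/-- The point with the weights of `pt02` on the edge from `1` to `4`. -/
noncomputable def pt14 (t : ℝ) : Fin 4 → ℝ :=
  ![1 / (1 + t), 1 / (t * (1 + t)), t / (1 + t), 1]

/-- The point with the weights of `pt02` on the edge from `2` to `4`. -/
noncomputable def pt24 (t : ℝ) : Fin 4 → ℝ := ![1 / (1 + t), 1 / (t * (1 + t)), t, 1]

end Points

/-! ### The twelve tubes -/

section Tubes

variable (t : ℝ)

/-- The swipe of the snake `alpha` in `conv(B'0124)` from the simplex with the vertices
`B'`, `ptM t`, `0`, `pt02 t` in the direction `3`. -/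
noncomputable def alpha0 (ht : 1 ≤ t) : Tube 3 where
  dir := 3
  vertex := ![ptB t, ptM t, 0, pt02 t]
  push := ![0, 0, 1, 0]
  -- In the cell B'0124 a point has weight `gam t * lam3 t` at B', `x 0` at 4 and `bal + x 0` at 0.
  -- Half of M's weight accounts for that of 4, leaving `bal` at 0. The remaining weights, `(lam1 -
  -- lam3) / t²` at 1 and `(lam2 - lam3) / t` at 2, are rewritten in terms of 0, 1 and 02; the
  -- height is the weight at 1. The other tubes over triangles 0ij follow the same pattern.
  weight := ![gam t • lam3 t, (2 : ℝ) • (coord 0),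
    (1 / t ^ 2) • (t ^ 2 • bal t (lam3 t) + (lam1 t - lam3 t) - t ^ 2 • (lam2 t - lam3 t)),
    ((1 + t) / t) • ((lam2 t - lam3 t))]
  height := (1 / t ^ 2) • ((lam1 t - lam3 t))
  push_nonneg := by
    have h0 : 0 < t := by linarith
    intro j
    fin_cases j <;> simp 
  push_pos := ⟨2, zero_lt_one⟩
  sum_weight := by
    have h0 : t ≠ 0 := by linarith
    have h1 : 1 + t ≠ 0 := by linarith
    have h2 : t + 1 ≠ 0 := by linarith
    intro x
    simp [Fin.sum_univ_four, lam1_apply, lam2_apply, lam3_apply, bal_apply, kap, gam]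
    field_simp
    ring
  eq_sum := by
    have h0 : t ≠ 0 := by linarith
    have h1 : 1 + t ≠ 0 := by linarith
    have h2 : t + 1 ≠ 0 := by linarith
    have h3 : t ^ 2 + t + 1 ≠ 0 := by positivity
    intro x
    ext i
    fin_cases i <;>
      simp [Fin.sum_univ_four, lam1_apply, lam2_apply, lam3_apply, bal_apply, kap, gam,
        ptB, removedVertex, ptM, pt02] <;>
      field_simp <;> ring

/-- The swipe of the snake `alpha` in `conv(B'0124)` from the simplex with the vertices
`B'`, `ptM t`, `pt1`, `pt02 t` in the direction `2`. -/
noncomputable def alpha1 (ht : 1 ≤ t) : Tube 3 where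
  dir := 2
  vertex := ![ptB t, ptM t, pt1, pt02 t]
  push := ![0, 0, t, 0]
  weight := ![gam t • lam3 t, (2 : ℝ) • (coord 0),
    (1 / t ^ 2) • ((lam1 t - lam3 t) + t • ((lam2 t - lam3 t) - bal t (lam3 t))),
    ((1 + t) / t) • (bal t (lam3 t))]
  height := (lam2 t - lam3 t) - bal t (lam3 t)
  push_nonneg := by
    have h0 : 0 < t := by linarith
    intro j
    fin_cases j <;> simp <;> positivity
  push_pos := ⟨2, by
    have h0 : 0 < t := by linarith
    change 0 < t
    positivity⟩
  sum_weight := by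
    have h0 : t ≠ 0 := by linarith
    have h1 : 1 + t ≠ 0 := by linarith
    have h2 : t + 1 ≠ 0 := by linarith
    intro x
    simp [Fin.sum_univ_four, lam1_apply, lam2_apply, lam3_apply, bal_apply, kap, gam]
    field_simp
    ring
  eq_sum := by
    have h0 : t ≠ 0 := by linarith
    have h1 : 1 + t ≠ 0 := by linarith
    have h2 : t + 1 ≠ 0 := by linarith
    have h3 : t ^ 2 + t + 1 ≠ 0 := by positivity
    intro x
    ext i
    fin_cases i <;>
      simp [Fin.sum_univ_four, lam1_apply, lam2_apply, lam3_apply, bal_apply, kap, gam,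
        ptB, removedVertex, ptM, pt1, pt02] <;>
      field_simp <;> ring

/-- The swipe of the snake `alpha` in `conv(B'0234)` from the simplex with the vertices
`B'`, `ptM t`, `pt2 t`, `pt02 t` in the direction `1`. -/
noncomputable def alpha2 (ht : 1 ≤ t) : Tube 3 where
  dir := 1
  vertex := ![ptB t, ptM t, pt2 t, pt02 t]
  push := ![0, 0, 1 / t, 1 / (t * (1 + t))]
  weight := ![gam t • lam1 t, (2 : ℝ) • (coord 0),
    (1 / t) • ((lam2 t - lam1 t) + t • (lam3 t - lam1 t) - bal t (lam1 t)),
    ((1 + t) / t) • (bal t (lam1 t))]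
  height := (1 / t) • ((lam3 t - lam1 t))
  push_nonneg := by
    have h0 : 0 < t := by linarith
    intro j
    fin_cases j <;> simp <;> positivity
  push_pos := ⟨2, by
    have h0 : 0 < t := by linarith
    change 0 < 1 / t
    positivity⟩
  sum_weight := by
    have h0 : t ≠ 0 := by linarith
    have h1 : 1 + t ≠ 0 := by linarith
    have h2 : t + 1 ≠ 0 := by linarith
    intro x
    simp [Fin.sum_univ_four, lam1_apply, lam2_apply, lam3_apply, bal_apply, kap, gam]
    field_simp
    ring
  eq_sum := by
    have h0 : t ≠ 0 := by linarith
    have h1 : 1 + t ≠ 0 := by linarith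
    have h2 : t + 1 ≠ 0 := by linarith
    have h3 : t ^ 2 + t + 1 ≠ 0 := by positivity
    intro x
    ext i
    fin_cases i <;>
      simp [Fin.sum_univ_four, lam1_apply, lam2_apply, lam3_apply, bal_apply, kap, gam,
        ptB, removedVertex, ptM, pt2, pt02] <;>
      field_simp <;> ring

/-- The swipe of the snake `alpha` in `conv(B'0134)` from the simplex with the vertices
`B'`, `ptM t`, `pt3 t`, `pt03 t` in the direction `3`. -/
noncomputable def alpha3 (ht : 1 ≤ t) : Tube 3 where
  dir := 3
  vertex := ![ptB t, ptM t, pt3 t, pt03 t]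
  push := ![0, 0, 0, t / (1 + t)]
  weight := ![gam t • lam2 t, (2 : ℝ) • (coord 0),
    (1 / t ^ 3) • (t ^ 3 • (lam3 t - lam2 t) - (lam1 t - lam2 t) - t ^ 2 • bal t (lam2 t)),
    ((1 + t) / t ^ 3) • ((lam1 t - lam2 t) + t ^ 2 • bal t (lam2 t))]
  height := (1 / t ^ 2) • ((lam1 t - lam2 t))
  push_nonneg := by
    have h0 : 0 < t := by linarith
    intro j
    fin_cases j <;> simp <;> positivity
  push_pos := ⟨3, by
    have h0 : 0 < t := by linarith
    change 0 < t / (1 + t)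
    positivity⟩
  sum_weight := by
    have h0 : t ≠ 0 := by linarith
    have h1 : 1 + t ≠ 0 := by linarith
    have h2 : t + 1 ≠ 0 := by linarith
    intro x
    simp [Fin.sum_univ_four, lam1_apply, lam2_apply, lam3_apply, bal_apply, kap, gam]
    field_simp
    ring
  eq_sum := by
    have h0 : t ≠ 0 := by linarith
    have h1 : 1 + t ≠ 0 := by linarith
    have h2 : t + 1 ≠ 0 := by linarith
    have h3 : t ^ 2 + t + 1 ≠ 0 := by positivity
    intro x
    ext i
    fin_cases i <;>
      simp [Fin.sum_univ_four, lam1_apply, lam2_apply, lam3_apply, bal_apply, kap, gam,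
        ptB, removedVertex, ptM, pt3, pt03] <;>
      field_simp <;> ring

/-- The swipe of the snake `alpha` in `conv(B'0134)` from the simplex with the vertices
`B'`, `ptM t`, `pt3 t`, `pt13 t` in the direction `0`. -/
noncomputable def alpha4 (ht : 1 ≤ t) : Tube 3 where
  dir := 0
  vertex := ![ptB t, ptM t, pt3 t, pt13 t]
  push := ![0, 0, 1, 1 / (1 + t)]
  -- On the other side of M the weight of 0 is the one absorbed by M, which leaves `-bal` at 4. This
  -- is the pattern of all tubes over triangles 4ij.
  weight := ![gam t • lam2 t, (2 : ℝ) • (bal t (lam2 t) + coord 0),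
    (1 / t ^ 3) • (t ^ 3 • ((lam3 t - lam2 t) - bal t (lam2 t)) - (lam1 t - lam2 t)),
    ((1 + t) / t ^ 3) • ((lam1 t - lam2 t))]
  height := -bal t (lam2 t)
  push_nonneg := by
    have h0 : 0 < t := by linarith
    intro j
    fin_cases j <;> simp <;> positivity
  push_pos := ⟨2, zero_lt_one⟩
  sum_weight := by
    have h0 : t ≠ 0 := by linarith
    have h1 : 1 + t ≠ 0 := by linarith
    have h2 : t + 1 ≠ 0 := by linarith
    intro x
    simp [Fin.sum_univ_four, lam1_apply, lam2_apply, lam3_apply, bal_apply, kap, gam]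
    field_simp
    ring
  eq_sum := by
    have h0 : t ≠ 0 := by linarith
    have h1 : 1 + t ≠ 0 := by linarith
    have h2 : t + 1 ≠ 0 := by linarith
    have h3 : t ^ 2 + t + 1 ≠ 0 := by positivity
    intro x
    ext i
    fin_cases i <;>
      simp [Fin.sum_univ_four, lam1_apply, lam2_apply, lam3_apply, bal_apply, kap, gam,
        ptB, removedVertex, ptM, pt3, pt13] <;>
      field_simp <;> ring

/-- The swipe of the snake `alpha` in `conv(B'0124)` from the simplex with the vertices
`B'`, `ptM t`, `pt4 t`, `pt14 t` in the direction `2`. -/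
noncomputable def alpha5 (ht : 1 ≤ t) : Tube 3 where
  dir := 2
  vertex := ![ptB t, ptM t, pt4 t, pt14 t]
  push := ![0, 0, 0, t ^ 2 / (1 + t)]
  weight := ![gam t • lam3 t, (2 : ℝ) • (bal t (lam3 t) + coord 0),
    (1 / t ^ 3) • (-(t ^ 3 • bal t (lam3 t)) - (lam1 t - lam3 t) - t • (lam2 t - lam3 t)),
    ((1 + t) / t ^ 3) • ((lam1 t - lam3 t) + t • (lam2 t - lam3 t))]
  height := (lam2 t - lam3 t)
  push_nonneg := by
    have h0 : 0 < t := by linarith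
    intro j
    fin_cases j <;> simp <;> positivity
  push_pos := ⟨3, by
    have h0 : 0 < t := by linarith
    change 0 < t ^ 2 / (1 + t)
    positivity⟩
  sum_weight := by
    have h0 : t ≠ 0 := by linarith
    have h1 : 1 + t ≠ 0 := by linarith
    have h2 : t + 1 ≠ 0 := by linarith
    intro x
    simp [Fin.sum_univ_four, lam1_apply, lam2_apply, lam3_apply, bal_apply, kap, gam]
    field_simp
    ring
  eq_sum := by
    have h0 : t ≠ 0 := by linarith
    have h1 : 1 + t ≠ 0 := by linarith
    have h2 : t + 1 ≠ 0 := by linarith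
    have h3 : t ^ 2 + t + 1 ≠ 0 := by positivity
    intro x
    ext i
    fin_cases i <;>
      simp [Fin.sum_univ_four, lam1_apply, lam2_apply, lam3_apply, bal_apply, kap, gam,
        ptB, removedVertex, ptM, pt4, pt14] <;>
      field_simp <;> ring

/-- The swipe of the snake `beta` in `conv(B'0234)` from the simplex with the vertices
`B'`, `ptM t`, `0`, `pt02 t` in the direction `1`. -/
noncomputable def beta0 (ht : 1 ≤ t) : Tube 3 where
  dir := 1
  vertex := ![ptB t, ptM t, 0, pt02 t]
  push := ![0, 0, 0, 1 / (t * (1 + t))]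
  weight := ![gam t • lam1 t, (2 : ℝ) • (coord 0),
    bal t (lam1 t) - (lam2 t - lam1 t) - t • (lam3 t - lam1 t),
    ((1 + t) / t) • ((lam2 t - lam1 t) + t • (lam3 t - lam1 t))]
  height := (1 / t) • ((lam3 t - lam1 t))
  push_nonneg := by
    have h0 : 0 < t := by linarith
    intro j
    fin_cases j <;> simp <;> positivity
  push_pos := ⟨3, by
    have h0 : 0 < t := by linarith
    change 0 < 1 / (t * (1 + t))
    positivity⟩
  sum_weight := by
    have h0 : t ≠ 0 := by linarith
    have h1 : 1 + t ≠ 0 := by linarith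
    have h2 : t + 1 ≠ 0 := by linarith
    intro x
    simp [Fin.sum_univ_four, lam1_apply, lam2_apply, lam3_apply, bal_apply, kap, gam]
    field_simp
    ring
  eq_sum := by
    have h0 : t ≠ 0 := by linarith
    have h1 : 1 + t ≠ 0 := by linarith
    have h2 : t + 1 ≠ 0 := by linarith
    have h3 : t ^ 2 + t + 1 ≠ 0 := by positivity
    intro x
    ext i
    fin_cases i <;>
      simp [Fin.sum_univ_four, lam1_apply, lam2_apply, lam3_apply, bal_apply, kap, gam,
        ptB, removedVertex, ptM, pt02] <;>
      field_simp <;> ring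

/-- The swipe of the snake `beta` in `conv(B'0134)` from the simplex with the vertices
`B'`, `ptM t`, `0`, `pt03 t` in the direction `3`. -/
noncomputable def beta1 (ht : 1 ≤ t) : Tube 3 where
  dir := 3
  vertex := ![ptB t, ptM t, 0, pt03 t]
  push := ![0, 0, 1, t / (1 + t)]
  weight := ![gam t • lam2 t, (2 : ℝ) • (coord 0),
    (1 / t ^ 2) • (t ^ 2 • bal t (lam2 t) + (lam1 t - lam2 t) - t ^ 3 • (lam3 t - lam2 t)),
    (1 + t) • ((lam3 t - lam2 t))]
  height := (1 / t ^ 2) • ((lam1 t - lam2 t))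
  push_nonneg := by
    have h0 : 0 < t := by linarith
    intro j
    fin_cases j <;> simp <;> positivity
  push_pos := ⟨2, zero_lt_one⟩
  sum_weight := by
    have h0 : t ≠ 0 := by linarith
    have h1 : 1 + t ≠ 0 := by linarith
    have h2 : t + 1 ≠ 0 := by linarith
    intro x
    simp [Fin.sum_univ_four, lam1_apply, lam2_apply, lam3_apply, bal_apply, kap, gam]
    field_simp
    ring
  eq_sum := by
    have h0 : t ≠ 0 := by linarith
    have h1 : 1 + t ≠ 0 := by linarith
    have h2 : t + 1 ≠ 0 := by linarith
    have h3 : t ^ 2 + t + 1 ≠ 0 := by positivity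
    intro x
    ext i
    fin_cases i <;>
      simp [Fin.sum_univ_four, lam1_apply, lam2_apply, lam3_apply, bal_apply, kap, gam,
        ptB, removedVertex, ptM, pt03] <;>
      field_simp <;> ring

/-- The swipe of the snake `beta` in `conv(B'0134)` from the simplex with the vertices
`B'`, `ptM t`, `pt1`, `pt13 t` in the direction `0`. -/
noncomputable def beta2 (ht : 1 ≤ t) : Tube 3 where
  dir := 0
  vertex := ![ptB t, ptM t, pt1, pt13 t]
  push := ![0, 0, 0, 1 / (1 + t)]
  weight := ![gam t • lam2 t, (2 : ℝ) • (bal t (lam2 t) + coord 0),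
    (1 / t ^ 2) • ((lam1 t - lam2 t) - t ^ 3 • ((lam3 t - lam2 t) - bal t (lam2 t))),
    (1 + t) • ((lam3 t - lam2 t) - bal t (lam2 t))]
  height := -bal t (lam2 t)
  push_nonneg := by
    have h0 : 0 < t := by linarith
    intro j
    fin_cases j <;> simp <;> positivity
  push_pos := ⟨3, by
    have h0 : 0 < t := by linarith
    change 0 < 1 / (1 + t)
    positivity⟩
  sum_weight := by
    have h0 : t ≠ 0 := by linarith
    have h1 : 1 + t ≠ 0 := by linarith
    have h2 : t + 1 ≠ 0 := by linarith
    intro x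
    simp [Fin.sum_univ_four, lam1_apply, lam2_apply, lam3_apply, bal_apply, kap, gam]
    field_simp
    ring
  eq_sum := by
    have h0 : t ≠ 0 := by linarith
    have h1 : 1 + t ≠ 0 := by linarith
    have h2 : t + 1 ≠ 0 := by linarith
    have h3 : t ^ 2 + t + 1 ≠ 0 := by positivity
    intro x
    ext i
    fin_cases i <;>
      simp [Fin.sum_univ_four, lam1_apply, lam2_apply, lam3_apply, bal_apply, kap, gam,
        ptB, removedVertex, ptM, pt1, pt13] <;>
      field_simp <;> ring

/-- The swipe of the snake `beta` in `conv(B'0124)` from the simplex with the vertices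
`B'`, `ptM t`, `pt1`, `pt14 t` in the direction `2`. -/
noncomputable def beta3 (ht : 1 ≤ t) : Tube 3 where
  dir := 2
  vertex := ![ptB t, ptM t, pt1, pt14 t]
  push := ![0, 0, t, t ^ 2 / (1 + t)]
  weight := ![gam t • lam3 t, (2 : ℝ) • (bal t (lam3 t) + coord 0),
    (1 / t ^ 2) • ((lam1 t - lam3 t) + t • (lam2 t - lam3 t) + t ^ 3 • bal t (lam3 t)),
    (1 + t) • (-bal t (lam3 t))]
  height := (lam2 t - lam3 t)
  push_nonneg := by
    have h0 : 0 < t := by linarith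
    intro j
    fin_cases j <;> simp <;> positivity
  push_pos := ⟨2, by
    have h0 : 0 < t := by linarith
    change 0 < t
    positivity⟩
  sum_weight := by
    have h0 : t ≠ 0 := by linarith
    have h1 : 1 + t ≠ 0 := by linarith
    have h2 : t + 1 ≠ 0 := by linarith
    intro x
    simp [Fin.sum_univ_four, lam1_apply, lam2_apply, lam3_apply, bal_apply, kap, gam]
    field_simp
    ring
  eq_sum := by
    have h0 : t ≠ 0 := by linarith
    have h1 : 1 + t ≠ 0 := by linarith
    have h2 : t + 1 ≠ 0 := by linarith
    have h3 : t ^ 2 + t + 1 ≠ 0 := by positivity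
    intro x
    ext i
    fin_cases i <;>
      simp [Fin.sum_univ_four, lam1_apply, lam2_apply, lam3_apply, bal_apply, kap, gam,
        ptB, removedVertex, ptM, pt1, pt14] <;>
      field_simp <;> ring

/-- The swipe of the snake `beta` in `conv(B'0234)` from the simplex with the vertices
`B'`, `ptM t`, `pt2 t`, `pt24 t` in the direction `1`. -/
noncomputable def beta4 (ht : 1 ≤ t) : Tube 3 where
  dir := 1
  vertex := ![ptB t, ptM t, pt2 t, pt24 t]
  push := ![0, 0, 1 / t, 0]
  weight := ![gam t • lam1 t, (2 : ℝ) • (bal t (lam1 t) + coord 0),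
    (1 / t) • ((lam2 t - lam1 t) + t • (lam3 t - lam1 t) + t ^ 2 • bal t (lam1 t)),
    (1 + t) • (-bal t (lam1 t))]
  height := (1 / t) • ((lam3 t - lam1 t))
  push_nonneg := by
    have h0 : 0 < t := by linarith
    intro j
    fin_cases j <;> simp <;> positivity
  push_pos := ⟨2, by
    have h0 : 0 < t := by linarith
    change 0 < 1 / t
    positivity⟩
  sum_weight := by
    have h0 : t ≠ 0 := by linarith
    have h1 : 1 + t ≠ 0 := by linarith
    have h2 : t + 1 ≠ 0 := by linarith
    intro x
    simp [Fin.sum_univ_four, lam1_apply, lam2_apply, lam3_apply, bal_apply, kap, gam]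
    field_simp
    ring
  eq_sum := by
    have h0 : t ≠ 0 := by linarith
    have h1 : 1 + t ≠ 0 := by linarith
    have h2 : t + 1 ≠ 0 := by linarith
    have h3 : t ^ 2 + t + 1 ≠ 0 := by positivity
    intro x
    ext i
    fin_cases i <;>
      simp [Fin.sum_univ_four, lam1_apply, lam2_apply, lam3_apply, bal_apply, kap, gam,
        ptB, removedVertex, ptM, pt2, pt24] <;>
      field_simp <;> ring

/-- The swipe of the snake `beta` in `conv(B'0234)` from the simplex with the vertices
`B'`, `ptM t`, `pt3 t`, `pt24 t` in the direction `0`. -/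
noncomputable def beta5 (ht : 1 ≤ t) : Tube 3 where
  dir := 0
  vertex := ![ptB t, ptM t, pt3 t, pt24 t]
  push := ![0, 0, 1, 0]
  weight := ![gam t • lam1 t, (2 : ℝ) • (bal t (lam1 t) + coord 0),
    (1 / t ^ 2) • (t ^ 2 • ((lam3 t - lam1 t) - bal t (lam1 t)) - (lam2 t - lam1 t)),
    ((1 + t) / t ^ 2) • ((lam2 t - lam1 t))]
  height := (1 / t ^ 2) • (-(t ^ 2 • bal t (lam1 t)) - (lam2 t - lam1 t))
  push_nonneg := by
    have h0 : 0 < t := by linarith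
    intro j
    fin_cases j <;> simp 
  push_pos := ⟨2, zero_lt_one⟩
  sum_weight := by
    have h0 : t ≠ 0 := by linarith
    have h1 : 1 + t ≠ 0 := by linarith
    have h2 : t + 1 ≠ 0 := by linarith
    intro x
    simp [Fin.sum_univ_four, lam1_apply, lam2_apply, lam3_apply, bal_apply, kap, gam]
    field_simp
    ring
  eq_sum := by
    have h0 : t ≠ 0 := by linarith
    have h1 : 1 + t ≠ 0 := by linarith
    have h2 : t + 1 ≠ 0 := by linarith
    have h3 : t ^ 2 + t + 1 ≠ 0 := by positivity
    intro x
    ext i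
    fin_cases i <;>
      simp [Fin.sum_univ_four, lam1_apply, lam2_apply, lam3_apply, bal_apply, kap, gam,
        ptB, removedVertex, ptM, pt3, pt24] <;>
      field_simp <;> ring

end Tubes

/-! ### The tubes as systems of linear inequalities -/

/-- The sign conditions that describe a tube. -/
structure Tube.Shape (T : Tube 3) (f m a h s g : (Fin 4 → ℝ) → ℝ) : Prop where
  weight_pos : ∀ x, (∀ j, 0 < T.weight j x) ↔ 0 < f x ∧ 0 < m x ∧ 0 < a x ∧ 0 < h x
  height_eq : ∃ c, 0 < c ∧ ∀ x, T.height x = c * s x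
  gap_eq : ∃ c, 0 < c ∧ ∀ x, T.length x - T.height x = c * g x

namespace Tube.Shape

variable {T : Tube 3} {f m a h s g : (Fin 4 → ℝ) → ℝ} {x : Fin 4 → ℝ}

theorem height_nonneg (hT : T.Shape f m a h s g) : 0 ≤ T.height x ↔ 0 ≤ s x := by
  obtain ⟨c, hc, h⟩ := hT.height_eq
  rw [h, mul_nonneg_iff_of_pos_left hc]

theorem height_pos (hT : T.Shape f m a h s g) : 0 < T.height x ↔ 0 < s x := by
  obtain ⟨c, hc, h⟩ := hT.height_eq
  rw [h, mul_pos_iff_of_pos_left hc]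

theorem height_le (hT : T.Shape f m a h s g) : T.height x ≤ T.length x ↔ 0 ≤ g x := by
  obtain ⟨c, hc, h⟩ := hT.gap_eq
  rw [← sub_nonneg, h, mul_nonneg_iff_of_pos_left hc]

theorem height_lt (hT : T.Shape f m a h s g) : T.height x < T.length x ↔ 0 < g x := by
  obtain ⟨c, hc, h⟩ := hT.gap_eq
  rw [← sub_pos, h, mul_pos_iff_of_pos_left hc]

theorem mem_inner (hT : T.Shape f m a h s g) : x ∈ T.inner ↔
    (0 < f x ∧ 0 < m x ∧ 0 < a x ∧ 0 < h x) ∧ 0 < s x ∧ 0 < g x := by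
  rw [← hT.weight_pos, ← hT.height_pos, ← hT.height_lt]
  rfl

end Tube.Shape

theorem Tube.length_eq (T : Tube 3) (x : Fin 4 → ℝ) :
    T.length x = T.push 0 * T.weight 0 x + T.push 1 * T.weight 1 x + T.push 2 * T.weight 2 x +
      T.push 3 * T.weight 3 x :=
  (T.length_apply x).trans (Fin.sum_univ_four _)

theorem gam_pos {t : ℝ} (ht : 0 < t) : 0 < gam t := by
  unfold gam
  positivity

section Shapes

variable {t : ℝ} (ht : 1 ≤ t)

/-- Clearing positive factors expresses each tube through `bal` and the differences of the three
functionals, so that membership in cells and labels becomes linear arithmetic. The vanishing of the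
last two functions of a shape gives the starting and the ending turning hyperplane. -/
theorem alpha0_shape : (alpha0 t ht).Shape (lam3 t)
    (fun x => x 0) (fun x => t ^ 2 * bal t (lam3 t) x + (lam1 t x - lam3 t x) - t ^ 2 * (lam2 t x - lam3 t x))
    (fun x => (lam2 t x - lam3 t x)) (fun x => (lam1 t x - lam3 t x))
    (fun x => bal t (lam3 t) x - (lam2 t x - lam3 t x)) := by
  have h0 : 0 < t := by linarith
  have hm : (0 : ℝ) < 2 := two_pos
  have ha : 0 < 1 / t ^ 2 := by positivity
  have hh : 0 < (1 + t) / t := by positivity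
  refine ⟨fun x => ?_, ⟨1 / t ^ 2, by positivity, fun x => rfl⟩, ⟨1, zero_lt_one, fun x => ?_⟩⟩
  · exact ⟨fun H => ⟨(mul_pos_iff_of_pos_left (gam_pos h0)).1 (H 0),
      (mul_pos_iff_of_pos_left hm).1 (H 1),
      (mul_pos_iff_of_pos_left ha).1 (H 2),
      (mul_pos_iff_of_pos_left hh).1 (H 3)⟩,
      fun ⟨H0, H1, H2, H3⟩ j => by
        fin_cases j
        exacts [mul_pos (gam_pos h0) H0, mul_pos hm H1, mul_pos ha H2,
          mul_pos hh H3]⟩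
  · rw [Tube.length_eq]
    simp [alpha0]
    field_simp
    ring

theorem alpha1_shape : (alpha1 t ht).Shape (lam3 t)
    (fun x => x 0) (fun x => (lam1 t x - lam3 t x) + t * ((lam2 t x - lam3 t x) - bal t (lam3 t) x))
    (fun x => bal t (lam3 t) x) (fun x => (lam2 t x - lam3 t x) - bal t (lam3 t) x)
    (fun x => (lam1 t x - lam3 t x)) := by
  have h0 : 0 < t := by linarith
  have hm : (0 : ℝ) < 2 := two_pos
  have ha : 0 < 1 / t ^ 2 := by positivity
  have hh : 0 < (1 + t) / t := by positivity
  refine ⟨fun x => ?_, ⟨1, zero_lt_one, fun x => by simp [alpha1]⟩, ⟨1 / t, by positivity, fun x => ?_⟩⟩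
  · exact ⟨fun H => ⟨(mul_pos_iff_of_pos_left (gam_pos h0)).1 (H 0),
      (mul_pos_iff_of_pos_left hm).1 (H 1),
      (mul_pos_iff_of_pos_left ha).1 (H 2),
      (mul_pos_iff_of_pos_left hh).1 (H 3)⟩,
      fun ⟨H0, H1, H2, H3⟩ j => by
        fin_cases j
        exacts [mul_pos (gam_pos h0) H0, mul_pos hm H1, mul_pos ha H2,
          mul_pos hh H3]⟩
  · rw [Tube.length_eq]
    simp [alpha1]
    field_simp
    ring

theorem alpha2_shape : (alpha2 t ht).Shape (lam1 t)
    (fun x => x 0) (fun x => (lam2 t x - lam1 t x) + t * (lam3 t x - lam1 t x) - bal t (lam1 t) x)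
    (fun x => bal t (lam1 t) x) (fun x => (lam3 t x - lam1 t x))
    (fun x => (lam2 t x - lam1 t x)) := by
  have h0 : 0 < t := by linarith
  have hm : (0 : ℝ) < 2 := two_pos
  have ha : 0 < 1 / t := by positivity
  have hh : 0 < (1 + t) / t := by positivity
  refine ⟨fun x => ?_, ⟨1 / t, by positivity, fun x => rfl⟩, ⟨1 / t ^ 2, by positivity, fun x => ?_⟩⟩
  · exact ⟨fun H => ⟨(mul_pos_iff_of_pos_left (gam_pos h0)).1 (H 0),
      (mul_pos_iff_of_pos_left hm).1 (H 1),
      (mul_pos_iff_of_pos_left ha).1 (H 2),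
      (mul_pos_iff_of_pos_left hh).1 (H 3)⟩,
      fun ⟨H0, H1, H2, H3⟩ j => by
        fin_cases j
        exacts [mul_pos (gam_pos h0) H0, mul_pos hm H1, mul_pos ha H2,
          mul_pos hh H3]⟩
  · rw [Tube.length_eq]
    simp [alpha2]
    field_simp
    ring

theorem alpha3_shape : (alpha3 t ht).Shape (lam2 t)
    (fun x => x 0) (fun x => t ^ 3 * (lam3 t x - lam2 t x) - (lam1 t x - lam2 t x) - t ^ 2 * bal t (lam2 t) x)
    (fun x => (lam1 t x - lam2 t x) + t ^ 2 * bal t (lam2 t) x) (fun x => (lam1 t x - lam2 t x))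
    (fun x => bal t (lam2 t) x) := by
  have h0 : 0 < t := by linarith
  have hm : (0 : ℝ) < 2 := two_pos
  have ha : 0 < 1 / t ^ 3 := by positivity
  have hh : 0 < (1 + t) / t ^ 3 := by positivity
  refine ⟨fun x => ?_, ⟨1 / t ^ 2, by positivity, fun x => rfl⟩, ⟨1, zero_lt_one, fun x => ?_⟩⟩
  · exact ⟨fun H => ⟨(mul_pos_iff_of_pos_left (gam_pos h0)).1 (H 0),
      (mul_pos_iff_of_pos_left hm).1 (H 1),
      (mul_pos_iff_of_pos_left ha).1 (H 2),
      (mul_pos_iff_of_pos_left hh).1 (H 3)⟩,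
      fun ⟨H0, H1, H2, H3⟩ j => by
        fin_cases j
        exacts [mul_pos (gam_pos h0) H0, mul_pos hm H1, mul_pos ha H2,
          mul_pos hh H3]⟩
  · rw [Tube.length_eq]
    simp [alpha3]
    field_simp
    ring

theorem alpha4_shape : (alpha4 t ht).Shape (lam2 t)
    (fun x => bal t (lam2 t) x + x 0) (fun x => t ^ 3 * ((lam3 t x - lam2 t x) - bal t (lam2 t) x) - (lam1 t x - lam2 t x))
    (fun x => (lam1 t x - lam2 t x)) (fun x => -bal t (lam2 t) x)
    (fun x => (lam3 t x - lam2 t x)) := by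
  have h0 : 0 < t := by linarith
  have hm : (0 : ℝ) < 2 := two_pos
  have ha : 0 < 1 / t ^ 3 := by positivity
  have hh : 0 < (1 + t) / t ^ 3 := by positivity
  refine ⟨fun x => ?_, ⟨1, zero_lt_one, fun x => by simp [alpha4]⟩, ⟨1, zero_lt_one, fun x => ?_⟩⟩
  · exact ⟨fun H => ⟨(mul_pos_iff_of_pos_left (gam_pos h0)).1 (H 0),
      (mul_pos_iff_of_pos_left hm).1 (H 1),
      (mul_pos_iff_of_pos_left ha).1 (H 2),
      (mul_pos_iff_of_pos_left hh).1 (H 3)⟩,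
      fun ⟨H0, H1, H2, H3⟩ j => by
        fin_cases j
        exacts [mul_pos (gam_pos h0) H0, mul_pos hm H1, mul_pos ha H2,
          mul_pos hh H3]⟩
  · rw [Tube.length_eq]
    simp [alpha4]
    field_simp
    ring

theorem alpha5_shape : (alpha5 t ht).Shape (lam3 t)
    (fun x => bal t (lam3 t) x + x 0) (fun x => -(t ^ 3 * bal t (lam3 t) x) - (lam1 t x - lam3 t x) - t * (lam2 t x - lam3 t x))
    (fun x => (lam1 t x - lam3 t x) + t * (lam2 t x - lam3 t x)) (fun x => (lam2 t x - lam3 t x))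
    (fun x => (lam1 t x - lam3 t x)) := by
  have h0 : 0 < t := by linarith
  have hm : (0 : ℝ) < 2 := two_pos
  have ha : 0 < 1 / t ^ 3 := by positivity
  have hh : 0 < (1 + t) / t ^ 3 := by positivity
  refine ⟨fun x => ?_, ⟨1, zero_lt_one, fun x => by simp [alpha5]⟩, ⟨1 / t, by positivity, fun x => ?_⟩⟩
  · exact ⟨fun H => ⟨(mul_pos_iff_of_pos_left (gam_pos h0)).1 (H 0),
      (mul_pos_iff_of_pos_left hm).1 (H 1),
      (mul_pos_iff_of_pos_left ha).1 (H 2),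
      (mul_pos_iff_of_pos_left hh).1 (H 3)⟩,
      fun ⟨H0, H1, H2, H3⟩ j => by
        fin_cases j
        exacts [mul_pos (gam_pos h0) H0, mul_pos hm H1, mul_pos ha H2,
          mul_pos hh H3]⟩
  · rw [Tube.length_eq]
    simp [alpha5]
    field_simp
    ring

theorem beta0_shape : (beta0 t ht).Shape (lam1 t)
    (fun x => x 0) (fun x => bal t (lam1 t) x - (lam2 t x - lam1 t x) - t * (lam3 t x - lam1 t x))
    (fun x => (lam2 t x - lam1 t x) + t * (lam3 t x - lam1 t x)) (fun x => (lam3 t x - lam1 t x))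
    (fun x => (lam2 t x - lam1 t x)) := by
  have h0 : 0 < t := by linarith
  have hm : (0 : ℝ) < 2 := two_pos
  have hh : 0 < (1 + t) / t := by positivity
  refine ⟨fun x => ?_, ⟨1 / t, by positivity, fun x => rfl⟩, ⟨1 / t ^ 2, by positivity, fun x => ?_⟩⟩
  · exact ⟨fun H => ⟨(mul_pos_iff_of_pos_left (gam_pos h0)).1 (H 0),
      (mul_pos_iff_of_pos_left hm).1 (H 1),
      H 2,
      (mul_pos_iff_of_pos_left hh).1 (H 3)⟩,
      fun ⟨H0, H1, H2, H3⟩ j => by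
        fin_cases j
        exacts [mul_pos (gam_pos h0) H0, mul_pos hm H1, H2,
          mul_pos hh H3]⟩
  · rw [Tube.length_eq]
    simp [beta0]
    field_simp
    ring

theorem beta1_shape : (beta1 t ht).Shape (lam2 t)
    (fun x => x 0) (fun x => t ^ 2 * bal t (lam2 t) x + (lam1 t x - lam2 t x) - t ^ 3 * (lam3 t x - lam2 t x))
    (fun x => (lam3 t x - lam2 t x)) (fun x => (lam1 t x - lam2 t x))
    (fun x => bal t (lam2 t) x) := by
  have h0 : 0 < t := by linarith
  have hm : (0 : ℝ) < 2 := two_pos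
  have ha : 0 < 1 / t ^ 2 := by positivity
  have hh : 0 < 1 + t := by positivity
  refine ⟨fun x => ?_, ⟨1 / t ^ 2, by positivity, fun x => rfl⟩, ⟨1, zero_lt_one, fun x => ?_⟩⟩
  · exact ⟨fun H => ⟨(mul_pos_iff_of_pos_left (gam_pos h0)).1 (H 0),
      (mul_pos_iff_of_pos_left hm).1 (H 1),
      (mul_pos_iff_of_pos_left ha).1 (H 2),
      (mul_pos_iff_of_pos_left hh).1 (H 3)⟩,
      fun ⟨H0, H1, H2, H3⟩ j => by
        fin_cases j
        exacts [mul_pos (gam_pos h0) H0, mul_pos hm H1, mul_pos ha H2,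
          mul_pos hh H3]⟩
  · rw [Tube.length_eq]
    simp [beta1]
    field_simp
    ring

theorem beta2_shape : (beta2 t ht).Shape (lam2 t)
    (fun x => bal t (lam2 t) x + x 0) (fun x => (lam1 t x - lam2 t x) - t ^ 3 * ((lam3 t x - lam2 t x) - bal t (lam2 t) x))
    (fun x => (lam3 t x - lam2 t x) - bal t (lam2 t) x) (fun x => -bal t (lam2 t) x)
    (fun x => (lam3 t x - lam2 t x)) := by
  have h0 : 0 < t := by linarith
  have hm : (0 : ℝ) < 2 := two_pos
  have ha : 0 < 1 / t ^ 2 := by positivity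
  have hh : 0 < 1 + t := by positivity
  refine ⟨fun x => ?_, ⟨1, zero_lt_one, fun x => by simp [beta2]⟩, ⟨1, zero_lt_one, fun x => ?_⟩⟩
  · exact ⟨fun H => ⟨(mul_pos_iff_of_pos_left (gam_pos h0)).1 (H 0),
      (mul_pos_iff_of_pos_left hm).1 (H 1),
      (mul_pos_iff_of_pos_left ha).1 (H 2),
      (mul_pos_iff_of_pos_left hh).1 (H 3)⟩,
      fun ⟨H0, H1, H2, H3⟩ j => by
        fin_cases j
        exacts [mul_pos (gam_pos h0) H0, mul_pos hm H1, mul_pos ha H2,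
          mul_pos hh H3]⟩
  · rw [Tube.length_eq]
    simp [beta2]
    field_simp
    ring

theorem beta3_shape : (beta3 t ht).Shape (lam3 t)
    (fun x => bal t (lam3 t) x + x 0) (fun x => (lam1 t x - lam3 t x) + t * (lam2 t x - lam3 t x) + t ^ 3 * bal t (lam3 t) x)
    (fun x => -bal t (lam3 t) x) (fun x => (lam2 t x - lam3 t x))
    (fun x => (lam1 t x - lam3 t x)) := by
  have h0 : 0 < t := by linarith
  have hm : (0 : ℝ) < 2 := two_pos
  have ha : 0 < 1 / t ^ 2 := by positivity
  have hh : 0 < 1 + t := by positivity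
  refine ⟨fun x => ?_, ⟨1, zero_lt_one, fun x => by simp [beta3]⟩, ⟨1 / t, by positivity, fun x => ?_⟩⟩
  · exact ⟨fun H => ⟨(mul_pos_iff_of_pos_left (gam_pos h0)).1 (H 0),
      (mul_pos_iff_of_pos_left hm).1 (H 1),
      (mul_pos_iff_of_pos_left ha).1 (H 2),
      (mul_pos_iff_of_pos_left hh).1 (H 3)⟩,
      fun ⟨H0, H1, H2, H3⟩ j => by
        fin_cases j
        exacts [mul_pos (gam_pos h0) H0, mul_pos hm H1, mul_pos ha H2,
          mul_pos hh H3]⟩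
  · rw [Tube.length_eq]
    simp [beta3]
    field_simp
    ring

theorem beta4_shape : (beta4 t ht).Shape (lam1 t)
    (fun x => bal t (lam1 t) x + x 0) (fun x => (lam2 t x - lam1 t x) + t * (lam3 t x - lam1 t x) + t ^ 2 * bal t (lam1 t) x)
    (fun x => -bal t (lam1 t) x) (fun x => (lam3 t x - lam1 t x))
    (fun x => (lam2 t x - lam1 t x) + t ^ 2 * bal t (lam1 t) x) := by
  have h0 : 0 < t := by linarith
  have hm : (0 : ℝ) < 2 := two_pos
  have ha : 0 < 1 / t := by positivity
  have hh : 0 < 1 + t := by positivity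
  refine ⟨fun x => ?_, ⟨1 / t, by positivity, fun x => rfl⟩, ⟨1 / t ^ 2, by positivity, fun x => ?_⟩⟩
  · exact ⟨fun H => ⟨(mul_pos_iff_of_pos_left (gam_pos h0)).1 (H 0),
      (mul_pos_iff_of_pos_left hm).1 (H 1),
      (mul_pos_iff_of_pos_left ha).1 (H 2),
      (mul_pos_iff_of_pos_left hh).1 (H 3)⟩,
      fun ⟨H0, H1, H2, H3⟩ j => by
        fin_cases j
        exacts [mul_pos (gam_pos h0) H0, mul_pos hm H1, mul_pos ha H2,
          mul_pos hh H3]⟩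
  · rw [Tube.length_eq]
    simp [beta4]
    field_simp
    ring

theorem beta5_shape : (beta5 t ht).Shape (lam1 t)
    (fun x => bal t (lam1 t) x + x 0) (fun x => t ^ 2 * ((lam3 t x - lam1 t x) - bal t (lam1 t) x) - (lam2 t x - lam1 t x))
    (fun x => (lam2 t x - lam1 t x)) (fun x => -(t ^ 2 * bal t (lam1 t) x) - (lam2 t x - lam1 t x))
    (fun x => (lam3 t x - lam1 t x)) := by
  have h0 : 0 < t := by linarith
  have hm : (0 : ℝ) < 2 := two_pos
  have ha : 0 < 1 / t ^ 2 := by positivity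
  have hh : 0 < (1 + t) / t ^ 2 := by positivity
  refine ⟨fun x => ?_, ⟨1 / t ^ 2, by positivity, fun x => rfl⟩, ⟨1, zero_lt_one, fun x => ?_⟩⟩
  · exact ⟨fun H => ⟨(mul_pos_iff_of_pos_left (gam_pos h0)).1 (H 0),
      (mul_pos_iff_of_pos_left hm).1 (H 1),
      (mul_pos_iff_of_pos_left ha).1 (H 2),
      (mul_pos_iff_of_pos_left hh).1 (H 3)⟩,
      fun ⟨H0, H1, H2, H3⟩ j => by
        fin_cases j
        exacts [mul_pos (gam_pos h0) H0, mul_pos hm H1, mul_pos ha H2,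
          mul_pos hh H3]⟩
  · rw [Tube.length_eq]
    simp [beta5]
    field_simp
    ring

end Shapes

/-! ### Labels of the tubes -/

/-- The numbers from `0` to `5` label the tubes of the snake `alpha`, the numbers from `6` to `11`
those of the snake `beta`. -/
noncomputable def label (t : ℝ) (x : Fin 4 → ℝ) : ℕ :=
  -- The ties are broken so that a turning set goes to the tube which it starts. Both snakes pass
  -- between cells only in the cyclic order 124, 234, 134, 124, which fixes the cell for each tie of
  -- two functionals; and they pass from `bal > 0` to `bal < 0`, so `bal = 0` goes to the latter
  -- side.
  if lam3 t x ≤ lam2 t x ∧ lam3 t x < lam1 t x then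
    if 0 < bal t (lam3 t) x then
      if lam2 t x - lam3 t x < bal t (lam3 t) x then 0 else 1
    else
      if lam1 t x - lam3 t x + t * (lam2 t x - lam3 t x) < -(t ^ 3 * bal t (lam3 t) x)
      then 5 else 9
  else if lam1 t x ≤ lam3 t x ∧ lam1 t x < lam2 t x then
    if 0 < bal t (lam1 t) x then
      if bal t (lam1 t) x < lam2 t x - lam1 t x + t * (lam3 t x - lam1 t x) then 2 else 6
    else
      if -(t ^ 2 * bal t (lam1 t) x) < lam2 t x - lam1 t x then 10 else 11
  else
    if 0 < bal t (lam2 t) x then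
      if lam1 t x - lam2 t x + t ^ 2 * bal t (lam2 t) x < t ^ 3 * (lam3 t x - lam2 t x)
      then 3 else 7
    else
      if lam1 t x - lam2 t x < t ^ 3 * (lam3 t x - lam2 t x - bal t (lam2 t) x) then 4 else 8

/-- The points of the cell that corresponds to `f`, apart from some boundary points. -/
def cell (t : ℝ) (f : (Fin 4 → ℝ) →ᵃ[ℝ] ℝ) : Set (Fin 4 → ℝ) :=
  {x | 0 < f x ∧ f x ≤ lam1 t x ∧ f x ≤ lam2 t x ∧ f x ≤ lam3 t x ∧ 0 < x 0 ∧
    0 ≤ bal t f x + x 0}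

section Labels

variable {t : ℝ} (ht : 1 ≤ t) {x : Fin 4 → ℝ}

theorem alpha0_subset (hw : ∀ j, 0 < (alpha0 t ht).weight j x)
    (h1 : 0 ≤ (alpha0 t ht).height x) (h2 : (alpha0 t ht).height x ≤ (alpha0 t ht).length x) :
    x ∈ cell t (lam3 t) := by
  have h0 : 0 < t := by linarith
  obtain ⟨hf, hm, ha, hh⟩ := ((alpha0_shape ht).weight_pos x).1 hw
  have hs := (alpha0_shape ht).height_nonneg.1 h1
  have hg := (alpha0_shape ht).height_le.1 h2
  refine ⟨hf, ?_, ?_, ?_, ?_, ?_⟩ <;> linarith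

/-- The height must be positive here, unlike for later tubes: the starting set lies on `lam1 =
lam3`, which the tie rule assigns to another cell. The same happens for the first tube of beta. -/
theorem label_alpha0 (hw : ∀ j, 0 < (alpha0 t ht).weight j x)
    (h1 : 0 < (alpha0 t ht).height x) (h2 : (alpha0 t ht).height x < (alpha0 t ht).length x) :
    label t x = 0 := by
  have h0 : 0 < t := by linarith
  obtain ⟨hf, hm, ha, hh⟩ := ((alpha0_shape ht).weight_pos x).1 hw
  have hs := (alpha0_shape ht).height_pos.1 h1
  have hg := (alpha0_shape ht).height_lt.1 h2
  rw [label, if_pos ⟨by linarith, by linarith⟩, if_pos (by linarith), if_pos (by linarith)]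

theorem alpha1_subset (hw : ∀ j, 0 < (alpha1 t ht).weight j x)
    (h1 : 0 ≤ (alpha1 t ht).height x) (h2 : (alpha1 t ht).height x ≤ (alpha1 t ht).length x) :
    x ∈ cell t (lam3 t) := by
  have h0 : 0 < t := by linarith
  obtain ⟨hf, hm, ha, hh⟩ := ((alpha1_shape ht).weight_pos x).1 hw
  have hs := (alpha1_shape ht).height_nonneg.1 h1
  have hg := (alpha1_shape ht).height_le.1 h2
  refine ⟨hf, ?_, ?_, ?_, ?_, ?_⟩ <;> linarith

theorem label_alpha1 (hw : ∀ j, 0 < (alpha1 t ht).weight j x)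
    (h1 : 0 ≤ (alpha1 t ht).height x) (h2 : (alpha1 t ht).height x < (alpha1 t ht).length x) :
    label t x = 1 := by
  have h0 : 0 < t := by linarith
  obtain ⟨hf, hm, ha, hh⟩ := ((alpha1_shape ht).weight_pos x).1 hw
  have hs := (alpha1_shape ht).height_nonneg.1 h1
  have hg := (alpha1_shape ht).height_lt.1 h2
  rw [label, if_pos ⟨by linarith, by linarith⟩, if_pos (by linarith), if_neg fun H => by linarith]

theorem alpha2_subset (hw : ∀ j, 0 < (alpha2 t ht).weight j x)
    (h1 : 0 ≤ (alpha2 t ht).height x) (h2 : (alpha2 t ht).height x ≤ (alpha2 t ht).length x) :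
    x ∈ cell t (lam1 t) := by
  have h0 : 0 < t := by linarith
  obtain ⟨hf, hm, ha, hh⟩ := ((alpha2_shape ht).weight_pos x).1 hw
  have hs := (alpha2_shape ht).height_nonneg.1 h1
  have hg := (alpha2_shape ht).height_le.1 h2
  refine ⟨hf, ?_, ?_, ?_, ?_, ?_⟩ <;> linarith

theorem label_alpha2 (hw : ∀ j, 0 < (alpha2 t ht).weight j x)
    (h1 : 0 ≤ (alpha2 t ht).height x) (h2 : (alpha2 t ht).height x < (alpha2 t ht).length x) :
    label t x = 2 := by
  have h0 : 0 < t := by linarith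
  obtain ⟨hf, hm, ha, hh⟩ := ((alpha2_shape ht).weight_pos x).1 hw
  have hs := (alpha2_shape ht).height_nonneg.1 h1
  have hg := (alpha2_shape ht).height_lt.1 h2
  rw [label, if_neg fun H => by linarith [H.1, H.2], if_pos ⟨by linarith, by linarith⟩, if_pos (by linarith), if_pos (by linarith)]

theorem alpha3_subset (hw : ∀ j, 0 < (alpha3 t ht).weight j x)
    (h1 : 0 ≤ (alpha3 t ht).height x) (h2 : (alpha3 t ht).height x ≤ (alpha3 t ht).length x) :
    x ∈ cell t (lam2 t) := by
  have h0 : 0 < t := by linarith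
  obtain ⟨hf, hm, ha, hh⟩ := ((alpha3_shape ht).weight_pos x).1 hw
  have hs := (alpha3_shape ht).height_nonneg.1 h1
  have hg := (alpha3_shape ht).height_le.1 h2
  have hd' : 0 ≤ t ^ 2 * bal t (lam2 t) x := mul_nonneg (pow_pos h0 2).le hg
  have hq : 0 < (lam3 t x - lam2 t x) := by
    refine pos_of_mul_pos_right (a := t ^ 3) ?_ (pow_pos h0 3).le
    linarith
  refine ⟨hf, ?_, ?_, ?_, ?_, ?_⟩ <;> linarith

theorem label_alpha3 (hw : ∀ j, 0 < (alpha3 t ht).weight j x)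
    (h1 : 0 ≤ (alpha3 t ht).height x) (h2 : (alpha3 t ht).height x < (alpha3 t ht).length x) :
    label t x = 3 := by
  have h0 : 0 < t := by linarith
  obtain ⟨hf, hm, ha, hh⟩ := ((alpha3_shape ht).weight_pos x).1 hw
  have hs := (alpha3_shape ht).height_nonneg.1 h1
  have hg := (alpha3_shape ht).height_lt.1 h2
  have hd' : 0 ≤ t ^ 2 * bal t (lam2 t) x := mul_nonneg (pow_pos h0 2).le hg.le
  have hq : 0 < (lam3 t x - lam2 t x) := by
    refine pos_of_mul_pos_right (a := t ^ 3) ?_ (pow_pos h0 3).le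
    linarith
  rw [label, if_neg fun H => by linarith [H.1, H.2], if_neg fun H => by linarith [H.1, H.2], if_pos (by linarith), if_pos (by linarith)]

theorem alpha4_subset (hw : ∀ j, 0 < (alpha4 t ht).weight j x)
    (h1 : 0 ≤ (alpha4 t ht).height x) (h2 : (alpha4 t ht).height x ≤ (alpha4 t ht).length x) :
    x ∈ cell t (lam2 t) := by
  have h0 : 0 < t := by linarith
  obtain ⟨hf, hm, ha, hh⟩ := ((alpha4_shape ht).weight_pos x).1 hw
  have hs := (alpha4_shape ht).height_nonneg.1 h1
  have hg := (alpha4_shape ht).height_le.1 h2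
  refine ⟨hf, ?_, ?_, ?_, ?_, ?_⟩ <;> linarith

theorem label_alpha4 (hw : ∀ j, 0 < (alpha4 t ht).weight j x)
    (h1 : 0 ≤ (alpha4 t ht).height x) (h2 : (alpha4 t ht).height x < (alpha4 t ht).length x) :
    label t x = 4 := by
  have h0 : 0 < t := by linarith
  obtain ⟨hf, hm, ha, hh⟩ := ((alpha4_shape ht).weight_pos x).1 hw
  have hs := (alpha4_shape ht).height_nonneg.1 h1
  have hg := (alpha4_shape ht).height_lt.1 h2
  rw [label, if_neg fun H => by linarith [H.1, H.2], if_neg fun H => by linarith [H.1, H.2], if_neg fun H => by linarith, if_pos (by linarith)]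

theorem alpha5_subset (hw : ∀ j, 0 < (alpha5 t ht).weight j x)
    (h1 : 0 ≤ (alpha5 t ht).height x) (h2 : (alpha5 t ht).height x ≤ (alpha5 t ht).length x) :
    x ∈ cell t (lam3 t) := by
  have h0 : 0 < t := by linarith
  obtain ⟨hf, hm, ha, hh⟩ := ((alpha5_shape ht).weight_pos x).1 hw
  have hs := (alpha5_shape ht).height_nonneg.1 h1
  have hg := (alpha5_shape ht).height_le.1 h2
  have hq : 0 ≤ t * (lam2 t x - lam3 t x) := mul_nonneg h0.le hs
  have hd : bal t (lam3 t) x < 0 := by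
    by_contra hcon
    have := mul_nonneg (pow_pos h0 3).le (not_lt.1 hcon)
    linarith
  refine ⟨hf, ?_, ?_, ?_, ?_, ?_⟩ <;> linarith

theorem label_alpha5 (hw : ∀ j, 0 < (alpha5 t ht).weight j x)
    (h1 : 0 ≤ (alpha5 t ht).height x) (h2 : (alpha5 t ht).height x < (alpha5 t ht).length x) :
    label t x = 5 := by
  have h0 : 0 < t := by linarith
  obtain ⟨hf, hm, ha, hh⟩ := ((alpha5_shape ht).weight_pos x).1 hw
  have hs := (alpha5_shape ht).height_nonneg.1 h1
  have hg := (alpha5_shape ht).height_lt.1 h2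
  have hq : 0 ≤ t * (lam2 t x - lam3 t x) := mul_nonneg h0.le hs
  have hd : bal t (lam3 t) x < 0 := by
    by_contra hcon
    have := mul_nonneg (pow_pos h0 3).le (not_lt.1 hcon)
    linarith
  rw [label, if_pos ⟨by linarith, by linarith⟩, if_neg fun H => by linarith, if_pos (by linarith)]

theorem beta0_subset (hw : ∀ j, 0 < (beta0 t ht).weight j x)
    (h1 : 0 ≤ (beta0 t ht).height x) (h2 : (beta0 t ht).height x ≤ (beta0 t ht).length x) :
    x ∈ cell t (lam1 t) := by
  have h0 : 0 < t := by linarith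
  obtain ⟨hf, hm, ha, hh⟩ := ((beta0_shape ht).weight_pos x).1 hw
  have hs := (beta0_shape ht).height_nonneg.1 h1
  have hg := (beta0_shape ht).height_le.1 h2
  have hq : 0 ≤ t * (lam3 t x - lam1 t x) := mul_nonneg h0.le hs
  refine ⟨hf, ?_, ?_, ?_, ?_, ?_⟩ <;> linarith

theorem label_beta0 (hw : ∀ j, 0 < (beta0 t ht).weight j x)
    (h1 : 0 < (beta0 t ht).height x) (h2 : (beta0 t ht).height x < (beta0 t ht).length x) :
    label t x = 6 := by
  have h0 : 0 < t := by linarith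
  obtain ⟨hf, hm, ha, hh⟩ := ((beta0_shape ht).weight_pos x).1 hw
  have hs := (beta0_shape ht).height_pos.1 h1
  have hg := (beta0_shape ht).height_lt.1 h2
  have hq : 0 ≤ t * (lam3 t x - lam1 t x) := mul_nonneg h0.le hs.le
  rw [label, if_neg fun H => by linarith [H.1, H.2], if_pos ⟨by linarith, by linarith⟩, if_pos (by linarith), if_neg fun H => by linarith]

theorem beta1_subset (hw : ∀ j, 0 < (beta1 t ht).weight j x)
    (h1 : 0 ≤ (beta1 t ht).height x) (h2 : (beta1 t ht).height x ≤ (beta1 t ht).length x) :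
    x ∈ cell t (lam2 t) := by
  have h0 : 0 < t := by linarith
  obtain ⟨hf, hm, ha, hh⟩ := ((beta1_shape ht).weight_pos x).1 hw
  have hs := (beta1_shape ht).height_nonneg.1 h1
  have hg := (beta1_shape ht).height_le.1 h2
  refine ⟨hf, ?_, ?_, ?_, ?_, ?_⟩ <;> linarith

theorem label_beta1 (hw : ∀ j, 0 < (beta1 t ht).weight j x)
    (h1 : 0 ≤ (beta1 t ht).height x) (h2 : (beta1 t ht).height x < (beta1 t ht).length x) :
    label t x = 7 := by
  have h0 : 0 < t := by linarith
  obtain ⟨hf, hm, ha, hh⟩ := ((beta1_shape ht).weight_pos x).1 hw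
  have hs := (beta1_shape ht).height_nonneg.1 h1
  have hg := (beta1_shape ht).height_lt.1 h2
  rw [label, if_neg fun H => by linarith [H.1, H.2], if_neg fun H => by linarith [H.1, H.2], if_pos (by linarith), if_neg fun H => by linarith]

theorem beta2_subset (hw : ∀ j, 0 < (beta2 t ht).weight j x)
    (h1 : 0 ≤ (beta2 t ht).height x) (h2 : (beta2 t ht).height x ≤ (beta2 t ht).length x) :
    x ∈ cell t (lam2 t) := by
  have h0 : 0 < t := by linarith
  obtain ⟨hf, hm, ha, hh⟩ := ((beta2_shape ht).weight_pos x).1 hw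
  have hs := (beta2_shape ht).height_nonneg.1 h1
  have hg := (beta2_shape ht).height_le.1 h2
  have hd' : 0 < t ^ 3 * ((lam3 t x - lam2 t x) - bal t (lam2 t) x) := mul_pos (pow_pos h0 3) hh
  refine ⟨hf, ?_, ?_, ?_, ?_, ?_⟩ <;> linarith

theorem label_beta2 (hw : ∀ j, 0 < (beta2 t ht).weight j x)
    (h1 : 0 ≤ (beta2 t ht).height x) (h2 : (beta2 t ht).height x < (beta2 t ht).length x) :
    label t x = 8 := by
  have h0 : 0 < t := by linarith
  obtain ⟨hf, hm, ha, hh⟩ := ((beta2_shape ht).weight_pos x).1 hw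
  have hs := (beta2_shape ht).height_nonneg.1 h1
  have hg := (beta2_shape ht).height_lt.1 h2
  have hd' : 0 < t ^ 3 * ((lam3 t x - lam2 t x) - bal t (lam2 t) x) := mul_pos (pow_pos h0 3) hh
  rw [label, if_neg fun H => by linarith [H.1, H.2], if_neg fun H => by linarith [H.1, H.2], if_neg fun H => by linarith, if_neg fun H => by linarith]

theorem beta3_subset (hw : ∀ j, 0 < (beta3 t ht).weight j x)
    (h1 : 0 ≤ (beta3 t ht).height x) (h2 : (beta3 t ht).height x ≤ (beta3 t ht).length x) :
    x ∈ cell t (lam3 t) := by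
  have h0 : 0 < t := by linarith
  obtain ⟨hf, hm, ha, hh⟩ := ((beta3_shape ht).weight_pos x).1 hw
  have hs := (beta3_shape ht).height_nonneg.1 h1
  have hg := (beta3_shape ht).height_le.1 h2
  refine ⟨hf, ?_, ?_, ?_, ?_, ?_⟩ <;> linarith

theorem label_beta3 (hw : ∀ j, 0 < (beta3 t ht).weight j x)
    (h1 : 0 ≤ (beta3 t ht).height x) (h2 : (beta3 t ht).height x < (beta3 t ht).length x) :
    label t x = 9 := by
  have h0 : 0 < t := by linarith
  obtain ⟨hf, hm, ha, hh⟩ := ((beta3_shape ht).weight_pos x).1 hw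
  have hs := (beta3_shape ht).height_nonneg.1 h1
  have hg := (beta3_shape ht).height_lt.1 h2
  rw [label, if_pos ⟨by linarith, by linarith⟩, if_neg fun H => by linarith, if_neg fun H => by linarith]

theorem beta4_subset (hw : ∀ j, 0 < (beta4 t ht).weight j x)
    (h1 : 0 ≤ (beta4 t ht).height x) (h2 : (beta4 t ht).height x ≤ (beta4 t ht).length x) :
    x ∈ cell t (lam1 t) := by
  have h0 : 0 < t := by linarith
  obtain ⟨hf, hm, ha, hh⟩ := ((beta4_shape ht).weight_pos x).1 hw
  have hs := (beta4_shape ht).height_nonneg.1 h1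
  have hg := (beta4_shape ht).height_le.1 h2
  have hd' : t ^ 2 * bal t (lam1 t) x < 0 := by
    have := mul_pos (pow_pos h0 2) hh
    linarith
  refine ⟨hf, ?_, ?_, ?_, ?_, ?_⟩ <;> linarith

theorem label_beta4 (hw : ∀ j, 0 < (beta4 t ht).weight j x)
    (h1 : 0 ≤ (beta4 t ht).height x) (h2 : (beta4 t ht).height x < (beta4 t ht).length x) :
    label t x = 10 := by
  have h0 : 0 < t := by linarith
  obtain ⟨hf, hm, ha, hh⟩ := ((beta4_shape ht).weight_pos x).1 hw
  have hs := (beta4_shape ht).height_nonneg.1 h1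
  have hg := (beta4_shape ht).height_lt.1 h2
  have hd' : t ^ 2 * bal t (lam1 t) x < 0 := by
    have := mul_pos (pow_pos h0 2) hh
    linarith
  rw [label, if_neg fun H => by linarith [H.1, H.2], if_pos ⟨by linarith, by linarith⟩, if_neg fun H => by linarith, if_pos (by linarith)]

theorem beta5_subset (hw : ∀ j, 0 < (beta5 t ht).weight j x)
    (h1 : 0 ≤ (beta5 t ht).height x) (h2 : (beta5 t ht).height x ≤ (beta5 t ht).length x) :
    x ∈ cell t (lam1 t) := by
  have h0 : 0 < t := by linarith
  obtain ⟨hf, hm, ha, hh⟩ := ((beta5_shape ht).weight_pos x).1 hw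
  have hs := (beta5_shape ht).height_nonneg.1 h1
  have hg := (beta5_shape ht).height_le.1 h2
  have hd : bal t (lam1 t) x < 0 := by
    by_contra hcon
    have := mul_nonneg (pow_pos h0 2).le (not_lt.1 hcon)
    linarith
  refine ⟨hf, ?_, ?_, ?_, ?_, ?_⟩ <;> linarith

theorem label_beta5 (hw : ∀ j, 0 < (beta5 t ht).weight j x)
    (h1 : 0 ≤ (beta5 t ht).height x) (h2 : (beta5 t ht).height x < (beta5 t ht).length x) :
    label t x = 11 := by
  have h0 : 0 < t := by linarith
  obtain ⟨hf, hm, ha, hh⟩ := ((beta5_shape ht).weight_pos x).1 hw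
  have hs := (beta5_shape ht).height_nonneg.1 h1
  have hg := (beta5_shape ht).height_lt.1 h2
  have hd : bal t (lam1 t) x < 0 := by
    by_contra hcon
    have := mul_nonneg (pow_pos h0 2).le (not_lt.1 hcon)
    linarith
  rw [label, if_neg fun H => by linarith [H.1, H.2], if_pos ⟨by linarith, by linarith⟩, if_neg fun H => by linarith, if_neg fun H => by linarith]

end Labels

/-! ### Every generic point of a cell is inside a tube -/

section Cover

variable {t : ℝ} (ht : 1 ≤ t) {x : Fin 4 → ℝ}

/-- The sign of `bal` selects the triangle 012 or 412. The former is cut along the segment (1,02),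
the latter along (1,14), and the last two hypotheses keep the point off these cuts. -/
theorem mem_inner_of_mem_cell124 (hf : 0 < lam3 t x) (hx : 0 < x 0)
    (hb : 0 < bal t (lam3 t) x + x 0) (hp : 0 < lam1 t x - lam3 t x)
    (hq : 0 < lam2 t x - lam3 t x) (hd : bal t (lam3 t) x ≠ 0)
    (h1 : bal t (lam3 t) x ≠ lam2 t x - lam3 t x)
    (h2 : lam1 t x - lam3 t x + t * (lam2 t x - lam3 t x) ≠ -(t ^ 3 * bal t (lam3 t) x)) :
    x ∈ (alpha0 t ht).inner ∨ x ∈ (alpha1 t ht).inner ∨ x ∈ (alpha5 t ht).inner ∨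
      x ∈ (beta3 t ht).inner := by
  have h0 : 0 < t := by linarith
  rcases hd.lt_or_gt with hd | hd
  · right; right
    have hq' := mul_pos h0 hq
    rcases h2.lt_or_gt with h | h
    · left
      exact (alpha5_shape ht).mem_inner.2 ⟨⟨hf, hb, by linarith, by linarith⟩, hq, hp⟩
    · right
      exact (beta3_shape ht).mem_inner.2 ⟨⟨hf, hb, by linarith, by linarith⟩, hq, hp⟩
  · rcases h1.lt_or_gt with h | h
    · right; left
      have := mul_pos h0 (sub_pos.2 h)
      exact (alpha1_shape ht).mem_inner.2 ⟨⟨hf, hx, by linarith, hd⟩, by linarith, hp⟩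
    · left
      have := mul_pos (pow_pos h0 2) (sub_pos.2 h)
      exact (alpha0_shape ht).mem_inner.2 ⟨⟨hf, hx, by linarith, hq⟩, hp, by linarith⟩

/-- The triangle 023 is cut along (02,03) and the triangle 423 along (3,24). -/
theorem mem_inner_of_mem_cell234 (hf : 0 < lam1 t x) (hx : 0 < x 0)
    (hb : 0 < bal t (lam1 t) x + x 0) (hp : 0 < lam2 t x - lam1 t x)
    (hq : 0 < lam3 t x - lam1 t x) (hd : bal t (lam1 t) x ≠ 0)
    (h1 : bal t (lam1 t) x ≠ lam2 t x - lam1 t x + t * (lam3 t x - lam1 t x))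
    (h2 : lam2 t x - lam1 t x ≠ -(t ^ 2 * bal t (lam1 t) x)) :
    x ∈ (alpha2 t ht).inner ∨ x ∈ (beta0 t ht).inner ∨ x ∈ (beta4 t ht).inner ∨
      x ∈ (beta5 t ht).inner := by
  have h0 : 0 < t := by linarith
  have hq' := mul_pos h0 hq
  have hq'' := mul_pos (pow_pos h0 2) hq
  rcases hd.lt_or_gt with hd | hd
  · right; right
    rcases h2.lt_or_gt with h | h
    · right
      exact (beta5_shape ht).mem_inner.2 ⟨⟨hf, hb, by linarith, hp⟩, by linarith, hq⟩
    · left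
      exact (beta4_shape ht).mem_inner.2 ⟨⟨hf, hb, by linarith, by linarith⟩, hq, by linarith⟩
  · rcases h1.lt_or_gt with h | h
    · left
      exact (alpha2_shape ht).mem_inner.2 ⟨⟨hf, hx, by linarith, hd⟩, hq, hp⟩
    · right; left
      exact (beta0_shape ht).mem_inner.2 ⟨⟨hf, hx, by linarith, by linarith⟩, hq, hp⟩

/-- The triangle 013 is cut along (03,13) and the triangle 413 along (13,14). -/
theorem mem_inner_of_mem_cell134 (hf : 0 < lam2 t x) (hx : 0 < x 0)
    (hb : 0 < bal t (lam2 t) x + x 0) (hp : 0 < lam1 t x - lam2 t x)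
    (hq : 0 < lam3 t x - lam2 t x) (hd : bal t (lam2 t) x ≠ 0)
    (h1 : lam1 t x - lam2 t x + t ^ 2 * bal t (lam2 t) x ≠ t ^ 3 * (lam3 t x - lam2 t x))
    (h2 : lam1 t x - lam2 t x ≠ t ^ 3 * (lam3 t x - lam2 t x - bal t (lam2 t) x)) :
    x ∈ (alpha3 t ht).inner ∨ x ∈ (beta1 t ht).inner ∨ x ∈ (alpha4 t ht).inner ∨
      x ∈ (beta2 t ht).inner := by
  have h0 : 0 < t := by linarith
  rcases hd.lt_or_gt with hd | hd
  · right; right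
    rcases h2.lt_or_gt with h | h
    · left
      exact (alpha4_shape ht).mem_inner.2 ⟨⟨hf, hb, by linarith, hp⟩, by linarith, hq⟩
    · right
      exact (beta2_shape ht).mem_inner.2 ⟨⟨hf, hb, by linarith, by linarith⟩, by linarith, hq⟩
  · have := mul_pos (pow_pos h0 2) hd
    rcases h1.lt_or_gt with h | h
    · left
      exact (alpha3_shape ht).mem_inner.2 ⟨⟨hf, hx, by linarith, by linarith⟩, hp, hd⟩
    · right; left
      exact (beta1_shape ht).mem_inner.2 ⟨⟨hf, hx, by linarith, hq⟩, hp, hd⟩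

end Cover

/-! ### The polytope `P_t` and its rank -/

theorem kap_nonneg {t : ℝ} (ht : 1 ≤ t) : 0 ≤ kap t := by
  have h : 1 ≤ t ^ 3 := one_le_pow₀ ht
  have h0 : 0 < t := by linarith
  exact div_nonneg (by linarith) (by positivity)

theorem kap_pos {t : ℝ} (ht : 1 < t) : 0 < kap t := by
  have h : 1 < t ^ 3 := one_lt_pow₀ ht (by norm_num)
  have h0 : 0 < t := by linarith
  exact div_pos (by linarith) (by positivity)

theorem convex_setOf_affine_nonneg {m : ℕ} {ι : Type*} (F : ι → (Fin m → ℝ) →ᵃ[ℝ] ℝ) :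
    Convex ℝ {x | ∀ i, 0 ≤ F i x} := by
  rw [ofPred_forall]
  exact convex_iInter fun i => (convex_Ici (0 : ℝ)).affine_preimage (F i)

section

variable {t : ℝ}

theorem stretchedL4_eq (ht : 1 ≤ t) :
    stretchedL4 t =
      {x | 0 ≤ lam1 t x ∧ 0 ≤ lam2 t x ∧ 0 ≤ lam3 t x ∧ 0 ≤ x 0 ∧ x 3 ≤ 1} := by
  have h0 : 0 < t := by linarith
  ext x
  simp only [mem_ofPred_eq, lam1_apply, lam2_apply, lam3_apply, sub_nonneg]
  constructor
  · rintro ⟨y, ⟨hm, hy⟩, rfl⟩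
    have h1 : y 0 ≤ y 1 := hm (by decide)
    have h2 : y 1 ≤ y 2 := hm (by decide)
    have h3 : y 2 ≤ y 3 := hm (by decide)
    have e1 : t ^ 2 * (1 / t * y 1) = t * y 1 := by field_simp
    have e2 : t * (1 / t * y 1) = y 1 := by field_simp
    simp only [Pi.mul_apply, Matrix.cons_val]
    rw [e1, e2]
    refine ⟨?_, mul_le_mul_of_nonneg_left h2 h0.le, by linarith, by linarith [(hy 0).1],
      by linarith [(hy 3).2]⟩
    have := mul_le_mul_of_nonneg_left h3 (pow_pos h0 2).le
    linarith
  · rintro ⟨h1, h2, h3, h4, h5⟩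
    have e1 : x 1 * t ≤ x 2 / t := by rw [le_div_iff₀ h0]; linarith
    have e2 : x 2 / t ≤ x 3 := by
      rw [div_le_iff₀ h0]
      have : t * (t * x 3 - x 2) = t ^ 2 * x 3 - t * x 2 := by ring
      nlinarith
    refine ⟨![x 0, t * x 1, x 2 / t, x 3], ⟨?_, ?_⟩, ?_⟩
    · rw [Fin.monotone_iff_le_succ]
      intro i
      fin_cases i <;> simp <;> linarith
    · intro i
      fin_cases i <;> simp <;> constructor <;> linarith
    · ext i
      fin_cases i <;> simp <;> field_simp

/-- The part of `L(4)_t` on one side of the facets of `conv(B'1234)`, for each of the three facets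
that contain `B'` and `4` and two of the vertices `1`, `2`, `3`. -/
def piece (t : ℝ) (f : (Fin 4 → ℝ) →ᵃ[ℝ] ℝ) : Set (Fin 4 → ℝ) :=
  {x | (0 ≤ lam1 t x ∧ 0 ≤ lam2 t x ∧ 0 ≤ lam3 t x ∧ 0 ≤ x 0 ∧ x 3 ≤ 1) ∧
    kap t * f x ≤ 1 - x 3}

theorem piece_eq (f : (Fin 4 → ℝ) →ᵃ[ℝ] ℝ) : piece t f =
    {x | ∀ i, 0 ≤ ![lam1 t, lam2 t, lam3 t, coord 0, AffineMap.const ℝ _ 1 - coord 3,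
      AffineMap.const ℝ _ 1 - coord 3 - kap t • f] i x} := by
  ext x
  simp [piece, Fin.forall_fin_succ]
  tauto

theorem convex_piece (f : (Fin 4 → ℝ) →ᵃ[ℝ] ℝ) : Convex ℝ (piece t f) := by
  rw [piece_eq]
  exact convex_setOf_affine_nonneg _

theorem isClosed_piece (f : (Fin 4 → ℝ) →ᵃ[ℝ] ℝ) : IsClosed (piece t f) := by
  rw [piece_eq, ofPred_forall]
  exact isClosed_iInter fun i =>
    isClosed_le continuous_const (AffineMap.continuous_of_finiteDimensional _)

theorem removedSimplex_subset_stretchedL4 (ht : 1 ≤ t) : removedSimplex t ⊆ stretchedL4 t := by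
  have h0 : 0 < t := by linarith
  have hc : Convex ℝ (stretchedL4 t) := by
    have : stretchedL4 t = {x | ∀ i, 0 ≤ ![lam1 t, lam2 t, lam3 t, coord 0,
        AffineMap.const ℝ _ 1 - coord 3] i x} := by
      rw [stretchedL4_eq ht]
      ext x
      simp [Fin.forall_fin_succ]
    rw [this]
    exact convex_setOf_affine_nonneg _
  refine convexHull_min ?_ hc
  rw [stretchedL4_eq ht]
  rintro _ ⟨i, rfl⟩
  have e1 : t ^ 2 * ((t + 1) / (2 * t)) - t * (t * (t + 1) ^ 2 / (2 * (t ^ 2 + t + 1))) =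
    t * (t + 1) / (2 * (t ^ 2 + t + 1)) := by field_simp; ring
  have e2 : t * (t + 1) ^ 2 / (2 * (t ^ 2 + t + 1)) - t ^ 2 * ((t + 1) / (2 * (t ^ 2 + t + 1))) =
    t * (t + 1) / (2 * (t ^ 2 + t + 1)) := by field_simp; ring
  have q1 : t ^ 2 - t * t = 0 := by ring
  have q2 : t * t⁻¹ = 1 := mul_inv_cancel₀ h0.ne'
  have q3 : t ^ 2 * t⁻¹ = t := by field_simp
  fin_cases i <;> simp [removedVertex, lam1_apply, lam2_apply, lam3_apply, -sub_nonneg, q1, q2, q3]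
  · rw [e1, e2]
    refine ⟨by positivity, by positivity, by positivity, ?_⟩
    rw [div_le_one (by positivity)]
    linarith
  · positivity
  · exact h0.le

/-- It suffices to look at the five vertices. The constant `kap t` is made for equality at B'; the
other vertices have `x 3 = 1` and non-negative functionals. -/
theorem kap_mul_ge_of_mem_removedSimplex (ht : 1 ≤ t) {x : Fin 4 → ℝ}
    (hx : x ∈ removedSimplex t) :
    1 - x 3 ≤ kap t * lam1 t x ∧ 1 - x 3 ≤ kap t * lam2 t x ∧ 1 - x 3 ≤ kap t * lam3 t x := by
  have h0 : 0 < t := by linarith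
  have hk := kap_nonneg ht
  have e1 : t ^ 2 * ((t + 1) / (2 * t)) - t * (t * (t + 1) ^ 2 / (2 * (t ^ 2 + t + 1))) =
    t * (t + 1) / (2 * (t ^ 2 + t + 1)) := by field_simp; ring
  have e2 : t * (t + 1) ^ 2 / (2 * (t ^ 2 + t + 1)) - t ^ 2 * ((t + 1) / (2 * (t ^ 2 + t + 1))) =
    t * (t + 1) / (2 * (t ^ 2 + t + 1)) := by field_simp; ring
  have e3 : kap t * (t * (t + 1) / (2 * (t ^ 2 + t + 1))) + (t + 1) / (2 * t) = 1 := by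
    unfold kap
    field_simp
    ring
  have q1 : t ^ 2 - t * t = 0 := by ring
  have q2 : t * t⁻¹ = 1 := mul_inv_cancel₀ h0.ne'
  have q3 : t ^ 2 * t⁻¹ = t := by field_simp
  let F : Fin 3 → (Fin 4 → ℝ) →ᵃ[ℝ] ℝ :=
    fun i => kap t • ![lam1 t, lam2 t, lam3 t] i - (AffineMap.const ℝ _ 1 - coord 3)
  have hc : removedSimplex t ⊆ {x | ∀ i, 0 ≤ F i x} := by
    refine convexHull_min ?_ (convex_setOf_affine_nonneg _)
    rintro _ ⟨i, rfl⟩ j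
    fin_cases i <;> fin_cases j <;> simp [F, removedVertex, lam1_apply, lam2_apply, lam3_apply, q1, q2, q3]
    · rw [e1, e3]
    · rw [e2, e3]
    · rw [← mul_div_assoc, e3]
    all_goals positivity
  have h := hc hx
  refine ⟨sub_nonneg.1 (h 0), sub_nonneg.1 (h 1), sub_nonneg.1 (h 2)⟩

theorem mem_removedSimplex (ht : 1 < t) {x : Fin 4 → ℝ} (h0 : 0 ≤ x 0) (h3 : x 3 ≤ 1)
    (h : 1 - x 3 ≤ kap t * lam1 t x ∧ 1 - x 3 ≤ kap t * lam2 t x ∧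
      1 - x 3 ≤ kap t * lam3 t x) : x ∈ removedSimplex t := by
  have ht0 : 0 < t := by linarith
  have hk := kap_pos ht
  have hc : ∀ a, 1 - x 3 ≤ kap t * a → 0 ≤ a - (1 - x 3) / kap t := fun a ha => by
    rw [sub_nonneg, div_le_iff₀ hk]
    linarith
  -- B' is the only vertex with last coordinate below 1, so `1 - x 3` determines its weight `gam t *
  -- c`; it contributes the same amount `c` to each of the three functionals.
  set c := (1 - x 3) / kap t with hcdef
  have hc0 : 0 ≤ c := div_nonneg (by linarith) hk.le
  have hck : 1 - x 3 = kap t * c := by rw [hcdef]; field_simp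
  refine mem_convexHull_range_iff.2 ⟨![gam t * c, 1 / t ^ 2 * (lam1 t x - c),
    1 / t * (lam2 t x - c), lam3 t x - c, x 0], ?_, ?_, ?_⟩
  · have h1 := hc _ h.1
    have h2 := hc _ h.2.1
    have h3 := hc _ h.2.2
    have hg := gam_pos ht0
    intro j
    fin_cases j
    exacts [mul_nonneg hg.le hc0, mul_nonneg (by positivity) h1, mul_nonneg (by positivity) h2, h3,
      h0]
  · have hx3 : x 3 = 1 - kap t * c := by linarith
    simp [Fin.sum_univ_succ, lam1_apply, lam2_apply, lam3_apply, hx3, gam, kap]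
    field_simp
    ring
  · have hx3 : x 3 = 1 - kap t * c := by linarith
    ext i
    fin_cases i <;>
      simp [Fin.sum_univ_succ, lam1_apply, lam2_apply, lam3_apply, hx3, gam, kap, removedVertex] <;>
      field_simp <;> ring

theorem affineIndependent_removedVertex (ht : 1 < t) : AffineIndependent ℝ (removedVertex t) := by
  have h0 : 0 < t := by linarith
  suffices key : ∀ w w' : Fin 5 → ℝ, ∑ j, w j = 1 → ∑ j, w' j = 1 →
      ∑ j, w j • removedVertex t j = ∑ j, w' j • removedVertex t j → w = w' from
    affineIndependent_of_weights_unique key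
  intro w w' hw hw' h
  have c0 := congrFun h 0
  have c1 := congrFun h 1
  have c2 := congrFun h 2
  have c3 := congrFun h 3
  simp only [Fin.sum_univ_five, removedVertex, Pi.add_apply, Pi.smul_apply, smul_eq_mul,
    Matrix.cons_val] at c0 c1 c2 c3 hw hw'
  have hB : (t + 1) / (2 * t) < 1 := by
    rw [div_lt_one (by positivity)]
    linarith
  have e0 : w 0 = w' 0 := by
    have : (w 0 - w' 0) * ((t + 1) / (2 * t) - 1) = 0 := by linarith
    rcases mul_eq_zero.1 this with h | h
    · linarith
    · linarith
  have e4 : w 4 = w' 4 := by linarith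
  rw [e0, e4] at c1
  have e3 : w 3 = w' 3 := mul_right_cancel₀ (one_div_pos.2 h0).ne' (by linarith)
  rw [e0, e4, e3] at c2
  have e2 : w 2 = w' 2 := mul_right_cancel₀ h0.ne' (by linarith)
  have e1 : w 1 = w' 1 := by linarith
  ext i
  fin_cases i
  exacts [e0, e1, e2, e3, e4]

/-- Outside conv(B'1234) one of the three facet inequalities at B' and 4 fails, and taking the
closure makes the failure weak. The pieces overlap; they are convex, closed and easy to test. -/
theorem deformedPolytope_eq (ht : 1 ≤ t) :
    deformedPolytope t = piece t (lam1 t) ∪ piece t (lam2 t) ∪ piece t (lam3 t) := by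
  apply Subset.antisymm
  · refine closure_minimal ?_ (((isClosed_piece _).union (isClosed_piece _)).union
      (isClosed_piece _))
    rintro x ⟨hx, hr⟩
    rw [stretchedL4_eq ht] at hx
    by_contra hcon
    simp only [mem_union, not_or, piece, mem_ofPred_eq, not_and, not_le] at hcon
    have h1 := hcon.1.1 hx
    have h2 := hcon.1.2 hx
    have h3 := hcon.2 hx
    rcases ht.eq_or_lt with rfl | ht
    -- For t = 1 the three inequalities that define the pieces reduce to `x 3 ≤ 1`.
    · have : kap 1 = 0 := by simp [kap]
      rw [this] at h1
      linarith [hx.2.2.2.2]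
    · exact hr (mem_removedSimplex ht hx.2.2.2.1 hx.2.2.2.2 ⟨h1.le, h2.le, h3.le⟩)
  · have key : ∀ f : (Fin 4 → ℝ) →ᵃ[ℝ] ℝ, (∀ (a : ℝ) x, f (a • x) = a * f x) →
        (∀ x ∈ removedSimplex t, 1 - x 3 ≤ kap t * f x) → piece t f ⊆ deformedPolytope t := by
      rintro f hf hr x ⟨⟨h1, h2, h3, h4, h5⟩, h6⟩
      -- Contracting towards the origin makes the weak inequality strict: `kap t * f (a • x) ≤ a - a
      -- * x 3 < 1 - a * x 3` for `a < 1`. So `a • x` avoids the removed simplex.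
      have hcont : ContinuousWithinAt (fun a : ℝ => a • x) (Ioo 0 1) 1 :=
        (continuous_id.smul continuous_const).continuousWithinAt
      have := hcont.mem_closure (t := stretchedL4 t \ removedSimplex t)
        (by rw [closure_Ioo (zero_ne_one' ℝ)]; simp) ?_
      · simpa [deformedPolytope] using this
      · intro a ha
        refine ⟨?_, fun hax => ?_⟩
        · rw [stretchedL4_eq ht]
          simp only [mem_ofPred_eq, lam1_apply, lam2_apply, lam3_apply, Pi.smul_apply,
            smul_eq_mul] at *
          refine ⟨?_, ?_, ?_, mul_nonneg ha.1.le h4, by nlinarith [ha.1, ha.2]⟩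
          · have := mul_nonneg ha.1.le h1
            linarith
          · have := mul_nonneg ha.1.le h2
            linarith
          · have := mul_nonneg ha.1.le h3
            linarith
        · have h7 := hr _ hax
          rw [hf] at h7
          simp only [Pi.smul_apply, smul_eq_mul] at h7
          have h8 := mul_le_mul_of_nonneg_left h6 ha.1.le
          linarith [ha.2]
    refine union_subset (union_subset ?_ ?_) ?_
    · exact key _ (fun a x => by simp [lam1_apply]; ring)
        fun x hx => (kap_mul_ge_of_mem_removedSimplex ht hx).1
    · exact key _ (fun a x => by simp [lam2_apply]; ring)
        fun x hx => (kap_mul_ge_of_mem_removedSimplex ht hx).2.1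
    · exact key _ (fun a x => by simp [lam3_apply]; ring)
        fun x hx => (kap_mul_ge_of_mem_removedSimplex ht hx).2.2

/-- Applied to the smallest of the three functionals, the last clause says that the weight of 0 in
the corresponding cell is non-negative. -/
theorem nonneg_of_mem_deformedPolytope (ht : 1 ≤ t) {x : Fin 4 → ℝ} (hx : x ∈ deformedPolytope t) :
    0 ≤ lam1 t x ∧ 0 ≤ lam2 t x ∧ 0 ≤ lam3 t x ∧ 0 ≤ x 0 ∧
      ∀ f : (Fin 4 → ℝ) →ᵃ[ℝ] ℝ, f x ≤ lam1 t x → f x ≤ lam2 t x → f x ≤ lam3 t x →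
        0 ≤ bal t f x + x 0 := by
  rw [deformedPolytope_eq ht] at hx
  rcases hx with (⟨⟨h1, h2, h3, h4, h5⟩, h6⟩ | ⟨⟨h1, h2, h3, h4, h5⟩, h6⟩) |
    ⟨⟨h1, h2, h3, h4, h5⟩, h6⟩ <;>
  refine ⟨h1, h2, h3, h4, fun f f1 f2 f3 => ?_⟩ <;>
  rw [bal_apply]
  · linarith [mul_le_mul_of_nonneg_left f1 (kap_nonneg ht)]
  · linarith [mul_le_mul_of_nonneg_left f2 (kap_nonneg ht)]
  · linarith [mul_le_mul_of_nonneg_left f3 (kap_nonneg ht)]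

theorem deformedPolytope_one : deformedPolytope 1 = youngPolytope 4 := by
  rw [deformedPolytope_eq le_rfl]
  have hk : kap 1 = 0 := by simp [kap]
  have h : ∀ f, piece 1 f = stretchedL4 1 := by
    intro f
    rw [stretchedL4_eq le_rfl]
    ext x
    simp only [piece, mem_ofPred_eq, hk, zero_mul]
    exact ⟨fun h => h.1, fun h => ⟨h, by linarith [h.2.2.2.2]⟩⟩
  rw [h, h, h, union_self, union_self, stretchedL4, stretchedYoungPolytope]
  have : (![1, 1 / 1, 1, 1] : Fin 4 → ℝ) = 1 := by
    ext i
    fin_cases i <;> simp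
  rw [this]
  simp

theorem rk_four (x : Fin 4 → ℝ) : rk x = x 0 + x 1 + x 2 + x 3 := Fin.sum_univ_four x

theorem polytopeRank_deformedPolytope (ht : 1 ≤ t) :
    polytopeRank (deformedPolytope t) = t + 1 / t + 2 := by
  have h0 : 0 < t := by linarith
  have hmem : ∀ x ∈ deformedPolytope t, 0 ≤ lam1 t x ∧ 0 ≤ lam2 t x ∧ 0 ≤ lam3 t x ∧ 0 ≤ x 0 ∧
      x 3 ≤ 1 := by
    rw [deformedPolytope_eq ht]
    rintro x ((h | h) | h) <;> exact h.1
  have hsup : IsGreatest (rk '' deformedPolytope t) (t + 1 / t + 2) := by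
    refine ⟨⟨pt4 t, ?_, by simp [rk_four, pt4]; ring⟩, ?_⟩
    · rw [deformedPolytope_eq ht]
      left; left
      simp [piece, pt4, lam1_apply, lam2_apply, lam3_apply]
      field_simp
      simp
    · rintro _ ⟨x, hx, rfl⟩
      obtain ⟨h1, h2, h3, h4, h5⟩ := hmem x hx
      simp only [lam1_apply, lam2_apply, lam3_apply] at h1 h2 h3
      rw [rk_four]
      have e2 : x 2 ≤ t := by nlinarith
      have e1 : x 1 ≤ 1 / t := by
        rw [le_div_iff₀ h0]
        nlinarith
      have e0 : x 0 ≤ 1 := by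
        have := mul_le_mul_of_nonneg_left e1 h0.le
        rw [mul_one_div_cancel h0.ne'] at this
        linarith
      linarith
  have hinf : IsLeast (rk '' deformedPolytope t) 0 := by
    refine ⟨⟨0, ?_, by simp [rk_four]⟩, ?_⟩
    · rw [deformedPolytope_eq ht]
      left; left
      simp [piece, lam1_apply, lam2_apply, lam3_apply]
    · rintro _ ⟨x, hx, rfl⟩
      obtain ⟨h1, h2, h3, h4, h5⟩ := hmem x hx
      simp only [lam1_apply, lam2_apply, lam3_apply] at h1 h2 h3
      rw [rk_four]
      have e1 : 0 ≤ x 1 := by nlinarith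
      have e2 : 0 ≤ x 2 := by nlinarith [mul_nonneg (pow_pos h0 2).le e1]
      have e3 : 0 ≤ x 3 := by
        by_contra hcon
        nlinarith [mul_pos_of_neg_of_neg (not_le.1 hcon) (neg_neg_of_pos (pow_pos h0 2)),
          mul_nonneg h0.le e2]
      linarith
  rw [polytopeRank, hsup.csSup_eq, hinf.csInf_eq, add_zero]

end

open MeasureTheory

/-! ### Hyperplanes and null intersections -/

section ZeroLocus

variable {m : ℕ}

/-- The zero locus of an affine function. -/
noncomputable def zeroLocus (g : (Fin m → ℝ) →ᵃ[ℝ] ℝ) : AffineSubspace ℝ (Fin m → ℝ) :=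
  (AffineSubspace.mk' (0 : ℝ) ⊥).comap g

theorem mem_zeroLocus {g : (Fin m → ℝ) →ᵃ[ℝ] ℝ} {x : Fin m → ℝ} : x ∈ zeroLocus g ↔ g x = 0 := by
  simp [zeroLocus, AffineSubspace.mem_mk']

theorem zeroLocus_ne_top {g : (Fin m → ℝ) →ᵃ[ℝ] ℝ} (hg : ∃ x, g x ≠ 0) : zeroLocus g ≠ ⊤ := by
  obtain ⟨x, hx⟩ := hg
  intro h
  exact hx (mem_zeroLocus.1 (h ▸ AffineSubspace.mem_top ℝ _ x))

theorem convexHull_range_subset_nonneg {ι : Type*} {v : ι → Fin m → ℝ}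
    {g : (Fin m → ℝ) →ᵃ[ℝ] ℝ} (h : ∀ j, 0 ≤ g (v j)) :
    convexHull ℝ (range v) ⊆ {x | 0 ≤ g x} := by
  refine convexHull_min ?_ ((convex_Ici (0 : ℝ)).affine_preimage g)
  rintro _ ⟨j, rfl⟩
  exact h j

/-- A separating hyperplane contains the intersection and has measure zero. -/
theorem aedisjoint_convexHull {ι : Type*} {v v' : ι → Fin m → ℝ}
    (g : (Fin m → ℝ) →ᵃ[ℝ] ℝ) (h : ∀ j, 0 ≤ g (v j)) (h' : ∀ j, g (v' j) ≤ 0)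
    (hg : ∃ x, g x ≠ 0) (A : Set (Fin m → ℝ)) :
    AEDisjoint volume (convexHull ℝ (range v) ∩ A) (convexHull ℝ (range v') ∩ A) := by
  refine measure_mono_null ?_ (Measure.addHaar_affineSubspace volume _ (zeroLocus_ne_top hg))
  rintro x ⟨⟨hx, -⟩, hx', -⟩
  have h1 := convexHull_range_subset_nonneg h hx
  have h2 := convexHull_range_subset_nonneg (g := -g) (fun j => by simpa using h' j) hx'
  exact mem_zeroLocus.2 (le_antisymm (by simpa using h2) h1)

end ZeroLocus

/-! ### Rank distribution in a simplex -/

section Reflection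

variable {m : ℕ}

/-- The matrix of the edges at the first vertex of a simplex. -/
def edgeMatrix (p : Fin (m + 1) → Fin m → ℝ) : Matrix (Fin m) (Fin m) ℝ :=
  Matrix.of fun i j => p j.succ i - p 0 i

theorem rk_sum {ι : Type*} (s : Finset ι) (f : ι → Fin m → ℝ) :
    rk (∑ j ∈ s, f j) = ∑ j ∈ s, rk (f j) := by
  simp only [rk, Finset.sum_apply]
  exact Finset.sum_comm

theorem rk_add (x y : Fin m → ℝ) : rk (x + y) = rk x + rk y := by
  simp [rk, Finset.sum_add_distrib]

theorem rk_sub (x y : Fin m → ℝ) : rk (x - y) = rk x - rk y := by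
  simp [rk, Finset.sum_sub_distrib]

theorem rk_smul (a : ℝ) (x : Fin m → ℝ) : rk (a • x) = a * rk x := by
  simp [rk, Finset.mul_sum]

theorem toLin'_edgeMatrix (p : Fin (m + 1) → Fin m → ℝ) (w : Fin m → ℝ) :
    Matrix.toLin' (edgeMatrix p) w = ∑ j, w j • (p j.succ - p 0) := by
  ext i
  simp [Matrix.toLin'_apply, Matrix.mulVec, dotProduct, edgeMatrix, Finset.sum_apply, mul_comm]

/-- All weights but the first parametrise the simplex by a fixed corner simplex, on which the rank
is affine with coefficients given by the vertex ranks. The volume of a rank slice thus depends only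
on these ranks and the determinant of the edges. -/
theorem convexHull_inter_rk (p : Fin (m + 1) → Fin m → ℝ) (B : Set ℝ) :
    convexHull ℝ (range p) ∩ rk ⁻¹' B = (fun x => p 0 + x) '' (Matrix.toLin' (edgeMatrix p) ''
      {w | ((∀ j, 0 ≤ w j) ∧ ∑ j, w j ≤ 1) ∧
        rk (p 0) + ∑ j, w j * (rk (p j.succ) - rk (p 0)) ∈ B}) := by
  have hrk : ∀ w : Fin m → ℝ, rk (p 0 + Matrix.toLin' (edgeMatrix p) w) =
      rk (p 0) + ∑ j, w j * (rk (p j.succ) - rk (p 0)) := by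
    intro w
    rw [toLin'_edgeMatrix, rk_add, rk_sum]
    simp only [rk_smul, rk_sub]
  have hsum : ∀ (w : Fin m → ℝ), p 0 + Matrix.toLin' (edgeMatrix p) w =
      (1 - ∑ j, w j) • p 0 + ∑ j, w j • p j.succ := by
    intro w
    rw [toLin'_edgeMatrix]
    simp only [smul_sub, Finset.sum_sub_distrib, sub_smul, one_smul, Finset.sum_smul]
    abel
  ext x
  simp only [image_image, mem_inter_iff, mem_preimage, mem_image, mem_ofPred_eq,
    mem_convexHull_range_iff]
  constructor
  · rintro ⟨⟨w, hw, hs, rfl⟩, hB⟩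
    rw [Fin.sum_univ_succ] at hs
    have he : p 0 + Matrix.toLin' (edgeMatrix p) (fun j => w j.succ) = ∑ j, w j • p j := by
      rw [hsum, Fin.sum_univ_succ]
      congr 2
      linarith
    refine ⟨fun j => w j.succ, ⟨⟨fun j => hw _, by linarith [hw 0]⟩, ?_⟩, he⟩
    rw [← hrk, he]
    exact hB
  · rintro ⟨w, ⟨⟨hw, hs⟩, hB⟩, rfl⟩
    rw [hrk]
    refine ⟨⟨Fin.cons (1 - ∑ j, w j) w, ?_, ?_, ?_⟩, hB⟩
    · intro j
      refine Fin.cases ?_ (fun j => ?_) j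
      · simpa using hs
      · simpa using hw j
    · simp [Fin.sum_univ_succ]
    · rw [hsum]
      simp [Fin.sum_univ_succ]

/-- Two simplices of the same volume whose vertices have complementary ranks are reflections of
each other as far as the distribution of ranks is concerned. -/
theorem volume_convexHull_rk_le {p q : Fin (m + 1) → Fin m → ℝ} {R : ℝ}
    (hrk : ∀ j, rk (p j) + rk (q j) = R)
    (hdet : (edgeMatrix p).det = (edgeMatrix q).det) (r : ℝ) :
    volume (convexHull ℝ (range p) ∩ rk ⁻¹' Iic r) =
      volume (convexHull ℝ (range q) ∩ rk ⁻¹' Ici (R - r)) := by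
  rw [convexHull_inter_rk, convexHull_inter_rk]
  simp only [image_add_left, measure_preimage_add, Measure.addHaar_image_linearMap,
    LinearMap.det_toLin', hdet]
  congr 3
  ext w
  simp only [mem_Iic, mem_Ici]
  have hq : ∀ j, rk (q j) = R - rk (p j) := fun j => by linarith [hrk j]
  have : ∑ j, w j * (rk (q j.succ) - rk (q 0)) = -∑ j, w j * (rk (p j.succ) - rk (p 0)) := by
    rw [← Finset.sum_neg_distrib]
    refine Finset.sum_congr rfl fun j _ => ?_
    rw [hq, hq]
    ring
  rw [this, hq 0]
  constructor <;> rintro ⟨h1, h2⟩ <;> exact ⟨h1, by linarith⟩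

end Reflection

/-! ### Volume rank symmetry by dissection -/

section Dissection

variable (t : ℝ)

/-- The point of the edge from `1` to `2` the rank of which is complementary to that of `2`. -/
noncomputable def pt12 : Fin 4 → ℝ := ![0, 0, 1 / t, 1]

/-- The simplices of a dissection of `P_t`. -/
noncomputable def dissection : Fin 4 → Fin 5 → Fin 4 → ℝ :=
  ![![ptB t, 0, pt1, pt3 t, pt4 t], ![ptB t, 0, pt1, pt12 t, pt4 t],
    ![ptB t, 0, pt12 t, pt2 t, pt4 t], ![ptB t, 0, pt2 t, pt3 t, pt4 t]]

/-- The simplices of the same dissection of `P_t`, with the vertices ordered such that the ranks are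
complementary to those of the vertices of `dissection t`. -/
noncomputable def reflectedDissection : Fin 4 → Fin 5 → Fin 4 → ℝ :=
  ![![ptB t, pt4 t, pt3 t, pt1, 0], ![ptB t, pt4 t, pt3 t, pt2 t, 0],
    ![ptB t, pt4 t, pt2 t, pt12 t, 0], ![ptB t, pt4 t, pt12 t, pt1, 0]]

variable {t}

/-- The ranks of 0 and 4, of 1 and 3, and of 2 and `pt12` are complementary, while B' is
complementary to itself. The rank of 2 forces the position of `pt12`, and with it the cut of the
cell B'0124. -/
theorem rk_dissection (ht : 1 ≤ t) (i : Fin 4) (j : Fin 5) :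
    rk (dissection t i j) + rk (reflectedDissection t i j) = t + 1 / t + 2 := by
  have h0 : 0 < t := by linarith
  fin_cases i <;> fin_cases j <;>
    simp [dissection, reflectedDissection, rk_four, ptB, removedVertex, pt1, pt2, pt3, pt4, pt12] <;>
    field_simp <;> ring

set_option maxHeartbeats 1000000 in
-- the expansion of eight determinants
theorem det_dissection (ht : 1 ≤ t) (i : Fin 4) :
    (edgeMatrix (dissection t i)).det = (edgeMatrix (reflectedDissection t i)).det := by
  have h0 : 0 < t := by linarith
  fin_cases i
  all_goals
    simp [dissection, reflectedDissection, edgeMatrix, Matrix.det_succ_row_zero, Fin.sum_univ_succ,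
      Fin.succAbove, ptB, removedVertex, pt1, pt2, pt3, pt4, pt12]
    field_simp
    ring

/-- The functional that is minimal among `lam1 t`, `lam2 t` and `lam3 t` on a simplex of the
dissection. -/
noncomputable def minFunctional (t : ℝ) : Fin 4 → (Fin 4 → ℝ) →ᵃ[ℝ] ℝ :=
  ![lam2 t, lam3 t, lam3 t, lam1 t]

theorem dissection_mem_piece (ht : 1 ≤ t) (i : Fin 4) (j : Fin 5) :
    dissection t i j ∈ piece t (minFunctional t i) := by
  have h0 : 0 < t := by linarith
  have e1 : t ^ 2 * ((t + 1) / (2 * t)) - t * (t * (t + 1) ^ 2 / (2 * (t ^ 2 + t + 1))) =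
    t * (t + 1) / (2 * (t ^ 2 + t + 1)) := by field_simp; ring
  have e2 : t * (t + 1) ^ 2 / (2 * (t ^ 2 + t + 1)) - t ^ 2 * ((t + 1) / (2 * (t ^ 2 + t + 1))) =
    t * (t + 1) / (2 * (t ^ 2 + t + 1)) := by field_simp; ring
  have e3 : kap t * (t * (t + 1) / (2 * (t ^ 2 + t + 1))) + (t + 1) / (2 * t) = 1 := by
    unfold kap
    field_simp
    ring
  have e4 : t * ((t + 1) / (2 * (t ^ 2 + t + 1))) = t * (t + 1) / (2 * (t ^ 2 + t + 1)) := by ring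
  have e5 : (t + 1) / (2 * t) ≤ 1 := by
    rw [div_le_one (by positivity)]
    linarith
  have q1 : t ^ 2 - t * t = 0 := by ring
  have q2 : t * t⁻¹ = 1 := mul_inv_cancel₀ h0.ne'
  have q3 : t ^ 2 * t⁻¹ = t := by field_simp
  have q4 : 0 ≤ t * (t + 1) / (2 * (t ^ 2 + t + 1)) := by positivity
  have q6 : 0 ≤ t⁻¹ := by positivity
  have B : ∀ f, f = lam1 t ∨ f = lam2 t ∨ f = lam3 t → ptB t ∈ piece t f := by
    rintro f (rfl | rfl | rfl) <;>
      simp only [piece, ptB, removedVertex, lam1_apply, lam2_apply, lam3_apply, mem_ofPred_eq,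
        Matrix.cons_val, e1, e2, e4, sub_zero] <;>
      exact ⟨⟨q4, q4, q4, le_rfl, e5⟩, by linarith⟩
  fin_cases i <;> fin_cases j
  all_goals
    first
    | exact B _ (by simp [minFunctional])
    | simp [dissection, minFunctional, piece, pt1, pt2, pt3, pt4, pt12, lam1_apply, lam2_apply,
        lam3_apply, q1, q2, q3, q6, h0.le, -sub_nonneg]
  -- The value of `lam1` at `pt12` is `t² - 1`, which is where `1 ≤ t` enters.
  all_goals exact sub_nonneg.2 (one_le_pow₀ ht)

theorem deformedPolytope_eq_iUnion (ht : 1 ≤ t) :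
    deformedPolytope t = ⋃ i, convexHull ℝ (range (dissection t i)) := by
  have h0 : 0 < t := by linarith
  apply Subset.antisymm
  · intro x hx
    obtain ⟨h1, h2, h3, h4, hk⟩ := nonneg_of_mem_deformedPolytope ht hx
    have hg := gam_pos h0
    have hmem : ∀ (i : Fin 4) (w : Fin 5 → ℝ), (∀ j, 0 ≤ w j) → ∑ j, w j = 1 →
        x = ∑ j, w j • dissection t i j → x ∈ ⋃ i, convexHull ℝ (range (dissection t i)) :=
      fun i w hw hs hx => mem_iUnion.2 ⟨i, mem_convexHull_range_iff.2 ⟨w, hw, hs, hx⟩⟩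
    by_cases c1 : lam2 t x ≤ lam1 t x ∧ lam2 t x ≤ lam3 t x
    · refine hmem 0 ![gam t * lam2 t x, bal t (lam2 t) x + x 0,
        1 / t ^ 2 * (lam1 t x - lam2 t x), lam3 t x - lam2 t x, x 0] ?_ ?_ ?_
      · intro j
        fin_cases j
        exacts [mul_nonneg hg.le h2, hk _ c1.1 le_rfl c1.2,
          mul_nonneg (by positivity) (sub_nonneg.2 c1.1), sub_nonneg.2 c1.2, h4]
      · simp [Fin.sum_univ_five, lam1_apply, lam2_apply, lam3_apply, bal_apply, gam, kap]
        field_simp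
        ring
      · ext i
        fin_cases i <;>
          simp [Fin.sum_univ_five, dissection, ptB, pt1, pt3, pt4, removedVertex, lam1_apply,
            lam2_apply, lam3_apply, bal_apply, gam, kap] <;>
          field_simp <;> ring
    by_cases c2 : lam1 t x ≤ lam2 t x ∧ lam1 t x ≤ lam3 t x
    · refine hmem 3 ![gam t * lam1 t x, bal t (lam1 t) x + x 0,
        1 / t * (lam2 t x - lam1 t x), lam3 t x - lam1 t x, x 0] ?_ ?_ ?_
      · intro j
        fin_cases j
        exacts [mul_nonneg hg.le h1, hk _ le_rfl c2.1 c2.2,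
          mul_nonneg (by positivity) (sub_nonneg.2 c2.1), sub_nonneg.2 c2.2, h4]
      · simp [Fin.sum_univ_five, lam1_apply, lam2_apply, lam3_apply, bal_apply, gam, kap]
        field_simp
        ring
      · ext i
        fin_cases i <;>
          simp [Fin.sum_univ_five, dissection, ptB, pt2, pt3, pt4, removedVertex, lam1_apply,
            lam2_apply, lam3_apply, bal_apply, gam, kap] <;>
          field_simp <;> ring
    have c3 : lam3 t x ≤ lam1 t x ∧ lam3 t x ≤ lam2 t x := by
      by_contra c3
      rw [not_and_or, not_le, not_le] at c1 c2 c3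
      rcases c1 with c1 | c1 <;> rcases c2 with c2 | c2 <;> rcases c3 with c3 | c3 <;> linarith
    -- Equality holds on the hyperplane through B', 0, `pt12` and 4, which cuts the cell in two.
    by_cases c4 : t * (t ^ 2 - 1) * (lam2 t x - lam3 t x) ≤ lam1 t x - lam3 t x
    · refine hmem 1 ![gam t * lam3 t x, bal t (lam3 t) x + x 0,
        1 / t ^ 2 * (lam1 t x - lam3 t x - t * (t ^ 2 - 1) * (lam2 t x - lam3 t x)),
        t * (lam2 t x - lam3 t x), x 0] ?_ ?_ ?_
      · intro j
        fin_cases j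
        exacts [mul_nonneg hg.le h3, hk _ c3.1 c3.2 le_rfl,
          mul_nonneg (by positivity) (sub_nonneg.2 c4), mul_nonneg h0.le (sub_nonneg.2 c3.2), h4]
      · simp [Fin.sum_univ_five, lam1_apply, lam2_apply, lam3_apply, bal_apply, gam, kap]
        field_simp
        ring
      · ext i
        fin_cases i <;>
          simp [Fin.sum_univ_five, dissection, ptB, pt1, pt12, pt4, removedVertex, lam1_apply,
            lam2_apply, lam3_apply, bal_apply, gam, kap] <;>
          field_simp <;> ring
    · rw [not_le] at c4
      -- For t = 1 the points `pt12` and 2 coincide and the simplex is degenerate, but then this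
      -- case does not occur.
      have ht1 : 0 < t ^ 2 - 1 := by
        by_contra hcon
        have h5 := mul_nonneg (mul_nonneg h0.le (neg_nonneg.2 (not_lt.1 hcon)))
          (sub_nonneg.2 c3.2)
        have h6 := sub_nonneg.2 c3.1
        linarith
      refine hmem 2 ![gam t * lam3 t x, bal t (lam3 t) x + x 0,
        1 / (t ^ 2 - 1) * (lam1 t x - lam3 t x),
        1 / (t ^ 2 * (t ^ 2 - 1)) *
          (t * (t ^ 2 - 1) * (lam2 t x - lam3 t x) - (lam1 t x - lam3 t x)), x 0] ?_ ?_ ?_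
      · intro j
        fin_cases j
        exacts [mul_nonneg hg.le h3, hk _ c3.1 c3.2 le_rfl,
          mul_nonneg (by positivity) (sub_nonneg.2 c3.1),
          mul_nonneg (by positivity) (sub_nonneg.2 c4.le), h4]
      · simp [Fin.sum_univ_five, lam1_apply, lam2_apply, lam3_apply, bal_apply, gam, kap]
        field_simp
        ring
      · ext i
        fin_cases i <;>
          simp [Fin.sum_univ_five, dissection, ptB, pt2, pt12, pt4, removedVertex, lam1_apply,
            lam2_apply, lam3_apply, bal_apply, gam, kap] <;>
          field_simp <;> ring
  · refine iUnion_subset fun i => (convexHull_min ?_ (convex_piece (t := t) (minFunctional t i))).trans ?_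
    · rintro _ ⟨j, rfl⟩
      exact dissection_mem_piece ht i j
    · rw [deformedPolytope_eq ht]
      fin_cases i
      exacts [fun x hx => Or.inl (Or.inr hx), fun x hx => Or.inr hx, fun x hx => Or.inr hx,
        fun x hx => Or.inl (Or.inl hx)]

theorem isPolytope_deformedPolytope (ht : 1 ≤ t) : IsPolytope (deformedPolytope t) := by
  rw [deformedPolytope_eq_iUnion ht]
  refine ⟨⟨dissection t 0 0, mem_iUnion.2 ⟨0, subset_convexHull ℝ _ ⟨0, rfl⟩⟩⟩,
    range fun i => range (dissection t i), finite_range _, ?_, ?_⟩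
  · rintro _ ⟨i, rfl⟩
    exact finite_range _
  · rw [biUnion_range]

theorem lam_ptB (ht : 1 ≤ t) :
    lam1 t (ptB t) = lam3 t (ptB t) ∧ lam2 t (ptB t) = lam3 t (ptB t) := by
  have h0 : 0 < t := by linarith
  simp only [lam1_apply, lam2_apply, lam3_apply, ptB, removedVertex, Matrix.cons_val]
  constructor <;> field_simp <;> ring

/-- Simplices from different cells are separated by a difference of two of the functionals, and the
two parts of the cell B'0124 by the hyperplane of the cut. -/
theorem aedisjoint_dissection (ht : 1 ≤ t) (B : Set (Fin 4 → ℝ)) : Pairwise fun i j =>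
    AEDisjoint volume (convexHull ℝ (range (dissection t i)) ∩ B)
      (convexHull ℝ (range (dissection t j)) ∩ B) := by
  have h0 : 0 < t := by linarith
  obtain ⟨b1, b2⟩ := lam_ptB ht
  have c1 := mul_inv_cancel₀ h0.ne'
  have c2 : t ^ 2 * t⁻¹ = t := by field_simp
  have c3 : t ^ 2 - t * t = 0 := by ring
  have c4 : 1 ≤ t ^ 2 := one_le_pow₀ ht
  have c5 : t * (t ^ 2 - 1) * t⁻¹ = t ^ 2 - 1 := by field_simp
  have c6 : 0 ≤ t * (t ^ 2 - 1) * t := by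
    have := sub_nonneg.2 c4
    positivity
  have key : ∀ i j : Fin 4, i < j →
      AEDisjoint volume (convexHull ℝ (range (dissection t i)) ∩ B)
        (convexHull ℝ (range (dissection t j)) ∩ B) := by
    have h01 : ∀ j, 0 ≤ (lam3 t - lam2 t) (dissection t 0 j) := by
      intro j
      fin_cases j <;>
        simp [dissection, b1, b2] <;>
        simp [lam2_apply, lam3_apply, pt1, pt3, pt4, c1, c2]
    have h0' : ∀ j, 0 ≤ (lam1 t - lam2 t) (dissection t 0 j) := by
      intro j
      fin_cases j <;>
        simp [dissection, b1, b2] <;>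
        simp [lam1_apply, lam2_apply, pt1, pt3, pt4, c1, c2, c3, h0.le]
    have h1 : ∀ j, (lam3 t - lam2 t) (dissection t 1 j) ≤ 0 := by
      intro j
      fin_cases j <;>
        simp [dissection, b1, b2] <;>
        simp [lam2_apply, lam3_apply, pt1, pt12, pt4, c1, c2, h0.le]
    have h1' : ∀ j, 0 ≤ ((lam1 t - lam3 t) - (t * (t ^ 2 - 1)) • (lam2 t - lam3 t))
        (dissection t 1 j) := by
      intro j
      fin_cases j <;>
        simp [dissection, b1, b2] <;>
        simp [lam1_apply, lam2_apply, lam3_apply, pt1, pt12, pt4, c1, c2, c3, c5, h0.le]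
    have h1'' : ∀ j, 0 ≤ (lam1 t - lam3 t) (dissection t 1 j) := by
      intro j
      fin_cases j <;>
        simp [dissection, b1, b2] <;>
        simp [lam1_apply, lam3_apply, pt1, pt12, pt4, c1, c2, c3, c4, h0.le]
    have h2 : ∀ j, (lam3 t - lam2 t) (dissection t 2 j) ≤ 0 := by
      intro j
      fin_cases j <;>
        simp [dissection, b1, b2] <;>
        simp [lam2_apply, lam3_apply, pt2, pt12, pt4, c1, c2, h0.le]
    have h2' : ∀ j, ((lam1 t - lam3 t) - (t * (t ^ 2 - 1)) • (lam2 t - lam3 t))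
        (dissection t 2 j) ≤ 0 := by
      intro j
      fin_cases j <;>
        simp [dissection, b1, b2] <;>
        simp [lam1_apply, lam2_apply, lam3_apply, pt2, pt12, pt4, c1, c2, c3, c5, c6, h0.le]
    have h2'' : ∀ j, 0 ≤ (lam1 t - lam3 t) (dissection t 2 j) := by
      intro j
      fin_cases j <;>
        simp [dissection, b1, b2] <;>
        simp [lam1_apply, lam3_apply, pt2, pt12, pt4, c1, c2, c3, c4, h0.le]
    have h3 : ∀ j, (lam1 t - lam2 t) (dissection t 3 j) ≤ 0 := by
      intro j
      fin_cases j <;>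
        simp [dissection, b1, b2] <;>
        simp [lam1_apply, lam2_apply, pt2, pt3, pt4, c1, c2, c3, h0.le]
    have h3' : ∀ j, (lam1 t - lam3 t) (dissection t 3 j) ≤ 0 := by
      intro j
      fin_cases j <;>
        simp [dissection, b1, b2] <;>
        simp [lam1_apply, lam3_apply, pt2, pt3, pt4, c1, c2, c3, h0.le]
    have n1 : ∃ x, (lam3 t - lam2 t) x ≠ 0 :=
      ⟨![0, 0, 1, 0], by simp [lam2_apply, lam3_apply]⟩
    have n2 : ∃ x, (lam1 t - lam2 t) x ≠ 0 :=
      ⟨![0, 0, 0, 1], by simp [lam1_apply, lam2_apply, h0.ne']⟩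
    have n3 : ∃ x, (lam1 t - lam3 t) x ≠ 0 :=
      ⟨![0, 0, 0, 1], by simp [lam1_apply, lam3_apply, h0.ne']⟩
    have n4 : ∃ x, ((lam1 t - lam3 t) - (t * (t ^ 2 - 1)) • (lam2 t - lam3 t)) x ≠ 0 :=
      ⟨![0, 0, 0, 1], by simp [lam1_apply, lam2_apply, lam3_apply, h0.ne']⟩
    intro i j hij
    fin_cases i <;> fin_cases j <;> first | exact absurd hij (by decide) | skip
    exacts [aedisjoint_convexHull _ h01 h1 n1 B, aedisjoint_convexHull _ h01 h2 n1 B,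
      aedisjoint_convexHull _ h0' h3 n2 B, aedisjoint_convexHull _ h1' h2' n4 B,
      aedisjoint_convexHull _ h1'' h3' n3 B, aedisjoint_convexHull _ h2'' h3' n3 B]
  intro i j hij
  rcases hij.lt_or_gt with h | h
  · exact key i j h
  · exact (key j i h).symm

theorem measurable_rk {m : ℕ} : Measurable (rk : (Fin m → ℝ) → ℝ) :=
  Finset.measurable_sum _ fun i _ => measurable_pi_apply i

theorem volumeRankSymmetric_deformedPolytope (ht : 1 ≤ t) :
    VolumeRankSymmetric (deformedPolytope t) := by
  intro r
  have hsum : ∀ B : Set ℝ, MeasurableSet B → volume (deformedPolytope t ∩ rk ⁻¹' B) =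
      ∑ i, volume (convexHull ℝ (range (dissection t i)) ∩ rk ⁻¹' B) := by
    intro B hB
    rw [deformedPolytope_eq_iUnion ht, iUnion_inter,
      measure_iUnion₀ (aedisjoint_dissection ht _) fun i => ?_, tsum_fintype]
    exact ((((finite_range _).isCompact_convexHull (𝕜 := ℝ)).isClosed.measurableSet).inter
      (measurable_rk hB)).nullMeasurableSet
  rw [polytopeRank_deformedPolytope ht]
  change volume (deformedPolytope t ∩ rk ⁻¹' Iic r) =
    volume (deformedPolytope t ∩ rk ⁻¹' Ici (t + 1 / t + 2 - r))
  -- The reflection exchanges the simplices with indices 1 and 3 and preserves the other two, so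
  -- only the order of the summands changes.
  have hr : ∀ i, range (reflectedDissection t i) = range (dissection t (![0, 3, 2, 1] i)) := by
    intro i
    fin_cases i <;> simp [reflectedDissection, dissection, Matrix.range_cons] <;> grind
  rw [hsum _ measurableSet_Iic, hsum _ measurableSet_Ici]
  simp_rw [fun i => volume_convexHull_rk_le (rk_dissection ht i) (det_dissection ht i) r, hr]
  simp only [Fin.sum_univ_four, Matrix.cons_val]
  ring

end Dissection

/-! ### The two snakes and the decomposition -/

theorem cell_subset_deformedPolytope {t : ℝ} (ht : 1 ≤ t) {f : (Fin 4 → ℝ) →ᵃ[ℝ] ℝ}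
    (hf : f = lam1 t ∨ f = lam2 t ∨ f = lam3 t) : cell t f ⊆ deformedPolytope t := by
  rw [deformedPolytope_eq ht]
  have key : cell t f ⊆ piece t f := by
    rintro x ⟨h, h1, h2, h3, h4, h5⟩
    rw [bal_apply] at h5
    have h6 := mul_nonneg (kap_nonneg ht) h.le
    refine ⟨⟨by linarith, by linarith, by linarith, h4.le, by linarith⟩, by linarith⟩
  rcases hf with rfl | rfl | rfl
  exacts [fun x hx => Or.inl (Or.inl (key hx)), fun x hx => Or.inl (Or.inr (key hx)),
    fun x hx => Or.inr (key hx)]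

/-- The affine functions that vanish somewhere on the boundary of one of the tubes. -/
noncomputable def wall (t : ℝ) : Fin 19 → (Fin 4 → ℝ) →ᵃ[ℝ] ℝ :=
  ![lam1 t, lam2 t, lam3 t, coord 0, lam1 t - lam2 t, lam2 t - lam3 t, lam3 t - lam1 t,
    bal t (lam1 t), bal t (lam2 t), bal t (lam3 t),
    bal t (lam1 t) + coord 0, bal t (lam2 t) + coord 0, bal t (lam3 t) + coord 0,
    bal t (lam3 t) - (lam2 t - lam3 t),
    lam1 t - lam3 t + t • (lam2 t - lam3 t) + t ^ 3 • bal t (lam3 t),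
    bal t (lam1 t) - (lam2 t - lam1 t + t • (lam3 t - lam1 t)),
    lam2 t - lam1 t + t ^ 2 • bal t (lam1 t),
    lam1 t - lam2 t + t ^ 2 • bal t (lam2 t) - t ^ 3 • (lam3 t - lam2 t),
    lam1 t - lam2 t - t ^ 3 • (lam3 t - lam2 t - bal t (lam2 t))]

/-- An affine function is determined by its values at the origin and the four unit vectors, so it
suffices to test there. -/
theorem wall_ne_zero {t : ℝ} (ht : 1 ≤ t) (i : Fin 19) : ∃ x, wall t i x ≠ 0 := by
  have h0 : t ≠ 0 := by linarith
  have key : wall t i ![0, 0, 0, 1] ≠ 0 ∨ wall t i ![0, 0, 1, 0] ≠ 0 ∨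
      wall t i ![0, 1, 0, 0] ≠ 0 ∨ wall t i ![1, 0, 0, 0] ≠ 0 ∨ wall t i 0 ≠ 0 := by
    fin_cases i <;> simp [wall, lam1_apply, lam2_apply, lam3_apply, bal_apply, h0]
  rcases key with h | h | h | h | h
  exacts [⟨_, h⟩, ⟨_, h⟩, ⟨_, h⟩, ⟨_, h⟩, ⟨_, h⟩]

section Snakes

variable {t : ℝ} (ht : 1 ≤ t)

/-- The tubes of the first snake. -/
noncomputable def alphaTubes : Fin 6 → Tube 3 :=
  ![alpha0 t ht, alpha1 t ht, alpha2 t ht, alpha3 t ht, alpha4 t ht, alpha5 t ht]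

/-- The tubes of the second snake. -/
noncomputable def betaTubes : Fin 6 → Tube 3 :=
  ![beta0 t ht, beta1 t ht, beta2 t ht, beta3 t ht, beta4 t ht, beta5 t ht]

theorem alphaTubes_compatible (i : Fin 5) (j : Fin 4) :
    (alphaTubes ht i.castSucc).pushedVertex j = (alphaTubes ht i.succ).vertex j := by
  have h0 : t ≠ 0 := by linarith
  have h1 : 1 + t ≠ 0 := by linarith
  fin_cases i <;> fin_cases j <;> ext l <;> fin_cases l <;>
    simp [Tube.pushedVertex, alphaTubes, alpha0, alpha1, alpha2, alpha3, alpha4, alpha5, pt1, pt2,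
      pt3, pt4, pt02, pt03, pt13, pt14]
  all_goals field_simp

theorem betaTubes_compatible (i : Fin 5) (j : Fin 4) :
    (betaTubes ht i.castSucc).pushedVertex j = (betaTubes ht i.succ).vertex j := by
  have h0 : t ≠ 0 := by linarith
  have h1 : 1 + t ≠ 0 := by linarith
  fin_cases i <;> fin_cases j <;> ext l <;> fin_cases l <;>
    simp [Tube.pushedVertex, betaTubes, beta0, beta1, beta2, beta3, beta4, beta5, pt1, pt2,
      pt3, pt02, pt03, pt13, pt14, pt24]
  all_goals field_simp

theorem isLabelling_alphaTubes : IsLabelling (alphaTubes ht) (label t) 0 := by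
  intro i x hw h1 h2 h3
  fin_cases i
  exacts [label_alpha0 ht hw (h3 rfl) h2, label_alpha1 ht hw h1 h2, label_alpha2 ht hw h1 h2,
    label_alpha3 ht hw h1 h2, label_alpha4 ht hw h1 h2, label_alpha5 ht hw h1 h2]

theorem isLabelling_betaTubes : IsLabelling (betaTubes ht) (label t) 6 := by
  intro i x hw h1 h2 h3
  fin_cases i
  exacts [label_beta0 ht hw (h3 rfl) h2, label_beta1 ht hw h1 h2, label_beta2 ht hw h1 h2,
    label_beta3 ht hw h1 h2, label_beta4 ht hw h1 h2, label_beta5 ht hw h1 h2]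

theorem alphaTubes_subset (i : Fin 6) :
    (alphaTubes ht i).toSwipe.carrier ⊆ deformedPolytope t := by
  intro x hx
  obtain ⟨hw, h1, h2⟩ := (Tube.mem_carrier_iff _).1 hx
  fin_cases i
  exacts [cell_subset_deformedPolytope ht (by simp) (alpha0_subset ht hw h1 h2),
    cell_subset_deformedPolytope ht (by simp) (alpha1_subset ht hw h1 h2),
    cell_subset_deformedPolytope ht (by simp) (alpha2_subset ht hw h1 h2),
    cell_subset_deformedPolytope ht (by simp) (alpha3_subset ht hw h1 h2),
    cell_subset_deformedPolytope ht (by simp) (alpha4_subset ht hw h1 h2),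
    cell_subset_deformedPolytope ht (by simp) (alpha5_subset ht hw h1 h2)]

theorem betaTubes_subset (i : Fin 6) :
    (betaTubes ht i).toSwipe.carrier ⊆ deformedPolytope t := by
  intro x hx
  obtain ⟨hw, h1, h2⟩ := (Tube.mem_carrier_iff _).1 hx
  fin_cases i
  exacts [cell_subset_deformedPolytope ht (by simp) (beta0_subset ht hw h1 h2),
    cell_subset_deformedPolytope ht (by simp) (beta1_subset ht hw h1 h2),
    cell_subset_deformedPolytope ht (by simp) (beta2_subset ht hw h1 h2),
    cell_subset_deformedPolytope ht (by simp) (beta3_subset ht hw h1 h2),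
    cell_subset_deformedPolytope ht (by simp) (beta4_subset ht hw h1 h2),
    cell_subset_deformedPolytope ht (by simp) (beta5_subset ht hw h1 h2)]

/-- Four affinely independent vertices leave no freedom beyond a common factor: the coefficients are
those of the walls `bal (lam3) = lam2 - lam3`, `lam1 = lam3`, `lam1 = lam2`, `bal (lam2) = 0` and
`lam2 = lam3`. At the first turn 1 and 02 both have rank one, so their difference is parallel to the
difference of the two directions. -/
theorem alphaTubes_weakHyperplane (i : Fin 5) : ∃ (a : Fin 4 → ℝ) (b : ℝ), a ≠ 0 ∧
    (∀ j : Fin 4, ∑ l, a l * (alphaTubes ht i.succ).vertex j l = b) ∧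
    a (alphaTubes ht i.castSucc).dir = a (alphaTubes ht i.succ).dir := by
  have h0 : t ≠ 0 := by linarith
  have h1 : 1 + t ≠ 0 := by linarith
  have h2 : t + 1 ≠ 0 := by linarith
  have h3 : t ^ 2 + t + 1 ≠ 0 := by positivity
  fin_cases i
  · refine ⟨![kap t - 2, (1 - kap t) * t + t ^ 2, -1, -1], -1,
      fun h => by simpa using congrFun h 3, fun j => ?_, by simp [alphaTubes, alpha0, alpha1]⟩
    fin_cases j <;>
      simp [alphaTubes, alpha1, Fin.sum_univ_four, ptB, removedVertex, ptM, pt1, pt02, kap] <;>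
      field_simp <;> ring
  · refine ⟨![1, -t, -t, t ^ 2], 0,
      fun h => by simpa using congrFun h 0, fun j => ?_, by simp [alphaTubes, alpha1, alpha2]⟩
    fin_cases j <;>
      simp [alphaTubes, alpha2, Fin.sum_univ_four, ptB, removedVertex, ptM, pt2, pt02] <;>
      field_simp <;> ring
  · refine ⟨![0, t ^ 2, -(t + 1), t ^ 2], 0,
      fun h => h0 (by simpa using congrFun h 1), fun j => ?_, by simp [alphaTubes, alpha2, alpha3]⟩
    fin_cases j <;>
      simp [alphaTubes, alpha3, Fin.sum_univ_four, ptB, removedVertex, ptM, pt3, pt03] <;>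
      field_simp <;> ring
  · refine ⟨![1, -(kap t * t ^ 2), kap t, 1], 1,
      fun h => by simpa using congrFun h 0, fun j => ?_, by simp [alphaTubes, alpha3, alpha4]⟩
    fin_cases j <;>
      simp [alphaTubes, alpha4, Fin.sum_univ_four, ptB, removedVertex, ptM, pt3, pt13, kap] <;>
      field_simp <;> ring
  · refine ⟨![1, -(t ^ 2 + t), 1, 0], 0,
      fun h => by simpa using congrFun h 0, fun j => ?_, by simp [alphaTubes, alpha4, alpha5]⟩
    fin_cases j <;>
      simp [alphaTubes, alpha5, Fin.sum_univ_four, ptB, removedVertex, ptM, pt4, pt14] <;>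
      field_simp <;> ring

/-- The first four hyperplanes also occur for alpha. The last is `lam2 - lam1 + t² bal (lam1) = 0`;
it contains 3 and 24, which have equal rank and differ only in the two directions of the turn. -/
theorem betaTubes_weakHyperplane (i : Fin 5) : ∃ (a : Fin 4 → ℝ) (b : ℝ), a ≠ 0 ∧
    (∀ j : Fin 4, ∑ l, a l * (betaTubes ht i.succ).vertex j l = b) ∧
    a (betaTubes ht i.castSucc).dir = a (betaTubes ht i.succ).dir := by
  have h0 : t ≠ 0 := by linarith
  have h1 : 1 + t ≠ 0 := by linarith
  have h2 : t + 1 ≠ 0 := by linarith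
  have h3 : t ^ 2 + t + 1 ≠ 0 := by positivity
  fin_cases i
  · refine ⟨![0, t ^ 2, -(t + 1), t ^ 2], 0,
      fun h => h0 (by simpa using congrFun h 1), fun j => ?_, by simp [betaTubes, beta0, beta1]⟩
    fin_cases j <;>
      simp [betaTubes, beta1, Fin.sum_univ_four, ptB, removedVertex, ptM, pt03] <;>
      field_simp <;> ring
  · refine ⟨![1, -(kap t * t ^ 2), kap t, 1], 1,
      fun h => by simpa using congrFun h 0, fun j => ?_, by simp [betaTubes, beta1, beta2]⟩
    fin_cases j <;>
      simp [betaTubes, beta2, Fin.sum_univ_four, ptB, removedVertex, ptM, pt1, pt13, kap] <;>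
      field_simp <;> ring
  · refine ⟨![1, -(t ^ 2 + t), 1, 0], 0,
      fun h => by simpa using congrFun h 0, fun j => ?_, by simp [betaTubes, beta2, beta3]⟩
    fin_cases j <;>
      simp [betaTubes, beta3, Fin.sum_univ_four, ptB, removedVertex, ptM, pt1, pt14] <;>
      field_simp <;> ring
  · refine ⟨![1, -t, -t, t ^ 2], 0,
      fun h => by simpa using congrFun h 0, fun j => ?_, by simp [betaTubes, beta3, beta4]⟩
    fin_cases j <;>
      simp [betaTubes, beta4, Fin.sum_univ_four, ptB, removedVertex, ptM, pt2, pt24] <;>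
      field_simp <;> ring
  · refine ⟨![-t ^ 2, -t ^ 2, 1 + t * (1 + kap t * t ^ 2), -(1 + kap t * t ^ 2) * t ^ 2 - t ^ 2],
      -t ^ 2, fun h => h0 (by simpa using congrFun h 1), fun j => ?_,
      by simp [betaTubes, beta4, beta5]⟩
    fin_cases j <;>
      simp [betaTubes, beta5, Fin.sum_univ_four, ptB, removedVertex, ptM, pt3, pt24, kap] <;>
      field_simp <;> ring

/-- B' and M stay fixed and have half the total rank; 0 arrives at 4, and 02, of rank one, arrives
at 24. -/
theorem alphaTubes_symmetric (j : Fin 4) :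
    rk ((alphaTubes ht 0).vertex j) + rk ((alphaTubes ht (Fin.last 5)).pushedVertex j) =
      polytopeRank (deformedPolytope t) := by
  have h0 : t ≠ 0 := by linarith
  have h1 : 1 + t ≠ 0 := by linarith
  have h3 : t ^ 2 + t + 1 ≠ 0 := by positivity
  rw [polytopeRank_deformedPolytope ht]
  fin_cases j <;>
    simp [-Matrix.cons_add, -Matrix.add_cons, alphaTubes, alpha0, alpha5, Tube.pushedVertex, rk_four,
      ptB, removedVertex, ptM, pt02, pt4, pt14, Fin.last] <;>
    field_simp <;> ring

theorem betaTubes_symmetric (j : Fin 4) :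
    rk ((betaTubes ht 0).vertex j) + rk ((betaTubes ht (Fin.last 5)).pushedVertex j) =
      polytopeRank (deformedPolytope t) := by
  have h0 : t ≠ 0 := by linarith
  have h1 : 1 + t ≠ 0 := by linarith
  have h3 : t ^ 2 + t + 1 ≠ 0 := by positivity
  rw [polytopeRank_deformedPolytope ht]
  fin_cases j <;>
    simp [-Matrix.cons_add, -Matrix.add_cons, betaTubes, beta0, beta5, Tube.pushedVertex, rk_four,
      ptB, removedVertex, ptM, pt02, pt3,
      pt24, Fin.last] <;>
    field_simp <;> ring

/-- Off the walls the inequalities of `P_t` are strict and the three functionals are distinct, so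
the smallest one selects a cell and the cover of that cell applies. -/
theorem exists_mem_inner {x : Fin 4 → ℝ} (hx : x ∈ deformedPolytope t)
    (hw : ∀ i, wall t i x ≠ 0) :
    (∃ i, x ∈ (alphaTubes ht i).inner) ∨ ∃ i, x ∈ (betaTubes ht i).inner := by
  have h0 : 0 < t := by linarith
  have hP : 0 ≤ lam1 t x ∧ 0 ≤ lam2 t x ∧ 0 ≤ lam3 t x ∧ 0 ≤ x 0 ∧
      ∀ f : (Fin 4 → ℝ) →ᵃ[ℝ] ℝ, f x ≤ lam1 t x → f x ≤ lam2 t x → f x ≤ lam3 t x →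
        0 ≤ bal t f x + x 0 := nonneg_of_mem_deformedPolytope ht hx
  obtain ⟨h1, h2, h3, h4, hk⟩ := hP
  have p1 : 0 < lam1 t x := lt_of_le_of_ne h1 (hw 0).symm
  have p2 : 0 < lam2 t x := lt_of_le_of_ne h2 (hw 1).symm
  have p3 : 0 < lam3 t x := lt_of_le_of_ne h3 (hw 2).symm
  have p4 : 0 < x 0 := lt_of_le_of_ne h4 (hw 3).symm
  have n12 : lam1 t x ≠ lam2 t x := sub_ne_zero.1 (hw 4)
  have n23 : lam2 t x ≠ lam3 t x := sub_ne_zero.1 (hw 5)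
  have n31 : lam3 t x ≠ lam1 t x := sub_ne_zero.1 (hw 6)
  by_cases c1 : lam1 t x < lam2 t x ∧ lam1 t x < lam3 t x
  · have hb := lt_of_le_of_ne (hk _ le_rfl c1.1.le c1.2.le) (hw 10).symm
    rcases mem_inner_of_mem_cell234 ht p1 p4 hb (sub_pos.2 c1.1) (sub_pos.2 c1.2) (hw 7)
      (sub_ne_zero.1 (hw 15)) (fun h => hw 16 (by
        change lam2 t x - lam1 t x + t ^ 2 * bal t (lam1 t) x = 0
        linarith)) with h | h | h | h
    exacts [Or.inl ⟨2, h⟩, Or.inr ⟨0, h⟩, Or.inr ⟨4, h⟩, Or.inr ⟨5, h⟩]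
  by_cases c2 : lam2 t x < lam1 t x ∧ lam2 t x < lam3 t x
  · have hb := lt_of_le_of_ne (hk _ c2.1.le le_rfl c2.2.le) (hw 11).symm
    rcases mem_inner_of_mem_cell134 ht p2 p4 hb (sub_pos.2 c2.1) (sub_pos.2 c2.2) (hw 8)
      (sub_ne_zero.1 (hw 17)) (sub_ne_zero.1 (hw 18)) with h | h | h | h
    exacts [Or.inl ⟨3, h⟩, Or.inr ⟨1, h⟩, Or.inl ⟨4, h⟩, Or.inr ⟨2, h⟩]
  have c3 : lam3 t x < lam1 t x ∧ lam3 t x < lam2 t x := by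
    rw [not_and_or, not_lt, not_lt] at c1 c2
    constructor
    · refine lt_of_le_of_ne ?_ n31
      rcases c1 with c | c
      · rcases c2 with d | d
        · exact absurd (le_antisymm d c) n12
        · exact d.trans c
      · exact c
    · refine lt_of_le_of_ne ?_ n23.symm
      rcases c2 with d | d
      · rcases c1 with c | c
        · exact absurd (le_antisymm d c) n12
        · exact c.trans d
      · exact d
  have hb := lt_of_le_of_ne (hk _ c3.1.le c3.2.le le_rfl) (hw 12).symm
  rcases mem_inner_of_mem_cell124 ht p3 p4 hb (sub_pos.2 c3.1) (sub_pos.2 c3.2) (hw 9)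
    (sub_ne_zero.1 (hw 13)) (fun h => hw 14 (by
      change lam1 t x - lam3 t x + t * (lam2 t x - lam3 t x) + t ^ 3 * bal t (lam3 t) x = 0
      linarith)) with h | h | h | h
  exacts [Or.inl ⟨0, h⟩, Or.inl ⟨1, h⟩, Or.inl ⟨5, h⟩, Or.inr ⟨3, h⟩]

/-- The two snakes that decompose `P_t`. -/
noncomputable def snakes : Fin 2 → Snake 4 :=
  ![.fake (tubeSeq (alphaTubes ht) (alphaTubes_compatible ht))
      (isFake_tubeSeq (isLabelling_alphaTubes ht)),
    .fake (tubeSeq (betaTubes ht) (betaTubes_compatible ht))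
      (isFake_tubeSeq (isLabelling_betaTubes ht))]

theorem snakes_subset (r : Fin 2) : (snakes ht r).carrier ⊆ deformedPolytope t := by
  fin_cases r
  · exact iUnion_subset fun i => sdiff_subset.trans (alphaTubes_subset ht i)
  · exact iUnion_subset fun i => sdiff_subset.trans (betaTubes_subset ht i)

theorem snakes_fullDim (r : Fin 2) : (interior (snakes ht r).carrier).Nonempty := by
  fin_cases r
  · refine (alphaTubes ht 0).inner_nonempty.mono (interior_maximal ?_ (Tube.isOpen_inner _))
    exact (inner_subset_trimmed_tubeSeq _).trans
      (subset_iUnion (tubeSeq (alphaTubes ht) (alphaTubes_compatible ht)).trimmed 0)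
  · refine (betaTubes ht 0).inner_nonempty.mono (interior_maximal ?_ (Tube.isOpen_inner _))
    exact (inner_subset_trimmed_tubeSeq _).trans
      (subset_iUnion (tubeSeq (betaTubes ht) (betaTubes_compatible ht)).trimmed 0)

/-- Labels are at most 5 on alpha and at least 6 on beta. This relies on trimming, since the
untrimmed sequences share their first and last turning sets. -/
theorem disjoint_snakes : Disjoint (snakes ht 0).carrier (snakes ht 1).carrier := by
  rw [Set.disjoint_left]
  intro x h1 h2
  have h1' := label_mem_of_mem_carrier (isLabelling_alphaTubes ht) h1
  have h2' := label_mem_of_mem_carrier (isLabelling_betaTubes ht) h2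
  omega

theorem snakes_cover : CodimAtLeastOne (deformedPolytope t \ ⋃ r, (snakes ht r).carrier) := by
  refine ⟨range fun i => zeroLocus (wall t i), finite_range _, ?_, ?_⟩
  · rintro _ ⟨i, rfl⟩
    exact zeroLocus_ne_top (wall_ne_zero ht i)
  · rintro x ⟨hx, hn⟩
    rw [biUnion_range, mem_iUnion]
    by_contra hcon
    rw [not_exists] at hcon
    apply hn
    rw [mem_iUnion]
    rcases exists_mem_inner ht hx (fun i h => hcon i (mem_zeroLocus.2 h)) with ⟨i, hi⟩ | ⟨i, hi⟩
    · exact ⟨0, mem_iUnion.2 ⟨i, inner_subset_trimmed_tubeSeq _ hi⟩⟩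
    · exact ⟨1, mem_iUnion.2 ⟨i, inner_subset_trimmed_tubeSeq _ hi⟩⟩

/-- The decomposition of `P_t` into two snakes. -/
noncomputable def deformedPolytopeGSCD : AsymptoticGSCD (deformedPolytope t) where
  isPolytope := isPolytope_deformedPolytope ht
  fullDim := (snakes_fullDim ht 0).mono (interior_mono (snakes_subset ht 0))
  num := 2
  snake := snakes ht
  subset := snakes_subset ht
  snake_fullDim := snakes_fullDim ht
  symmetric := fun r => by
    fin_cases r
    exacts [isSymmetric_tubeSeq (h := alphaTubes_compatible ht) (alphaTubes_symmetric ht),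
      isSymmetric_tubeSeq (h := betaTubes_compatible ht) (betaTubes_symmetric ht)]
  disjoint := fun r r' h => by
    fin_cases r <;> fin_cases r'
    exacts [absurd rfl h, disjoint_snakes ht, (disjoint_snakes ht).symm, absurd rfl h]
  cover := snakes_cover ht

theorem weakHyperplaneCondition_deformedPolytopeGSCD :
    (deformedPolytopeGSCD ht).WeakHyperplaneCondition := by
  intro (r : Fin 2)
  fin_cases r
  exacts [weakHyperplaneCondition_tubeSeq (h := alphaTubes_compatible ht)
      (alphaTubes_weakHyperplane ht),
    weakHyperplaneCondition_tubeSeq (h := betaTubes_compatible ht)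
      (betaTubes_weakHyperplane ht)]

end Snakes

end SymChain

theorem theorem3p7 :
    SymChain.deformedPolytope 1 = SymChain.youngPolytope 4 ∧
    ∀ t : ℝ, 1 ≤ t →
      SymChain.removedSimplex t ⊆ SymChain.stretchedL4 t ∧
      (1 < t → AffineIndependent ℝ (SymChain.removedVertex t)) ∧
      SymChain.VolumeRankSymmetric (SymChain.deformedPolytope t) ∧
      ∃ D : SymChain.AsymptoticGSCD (SymChain.deformedPolytope t), D.WeakHyperplaneCondition := by
  refine ⟨SymChain.deformedPolytope_one, fun t ht => ⟨?_, ?_, ?_, ?_⟩⟩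
  · exact SymChain.removedSimplex_subset_stretchedL4 ht
  · exact SymChain.affineIndependent_removedVertex
  · exact SymChain.volumeRankSymmetric_deformedPolytope ht
  · exact ⟨SymChain.deformedPolytopeGSCD ht,
      SymChain.weakHyperplaneCondition_deformedPolytopeGSCD ht⟩
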